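/- Let $V$ and $W$ be (complete) operator spaces over $\mathbb{C}$, with operator space duals $V^*=\mathcal{CB}(V,\mathbb{C})$ and $W^*=\mathcal{CB}(W,\mathbb{C})$, and let $\widehat\otimes$ denote the (completed) operator space projective tensor product. For an operator space $X$, let $\Psi:(V^*\widehat\otimes W^*)\widehat\otimes X\to\mathcal{JCB}(V\times W,X)$ be the canonical map into the jointly completely bounded bilinear maps, determined by $\Psi((f\otimes g)\otimes x)(v,w)=f(v)\,g(w)\,x$. The space $\mathcal{N}(V\times W,X)$ of completely nuclear bilinear maps is the image of $\Psi$ with the operator space structure of the quotient $\big((V^*\widehat\otimes W^*)\widehat\otimes X\big)/\ker\Psi$; write $\mathcal{N}(V\times W)=\mathcal{N}(V\times W,\mathbb{C})$. Similarly, the space $\mathcal{L}_{\mathcal N}(V,X)$ of completely nuclear linear maps is the image of the canonical map $L_\Psi:V^*\widehat\otimes X\to\mathcal{CB}(V,X)$, determined by $L_\Psi(f\otimes x)(v)=f(v)\,x$, with the operator space structure of the quotient $(V^*\widehat\otimes X)/\ker L_\Psi$. Then there is a completely isometric isomorphism $$\mathcal{N}(V\times W)\cong\mathcal{L}_{\mathcal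 N}(V,W^*),$$ given by $\phi\mapsto L_\phi$, where $L_\phi(v)(w)=\phi(v,w)$. That is, $\phi\mapsto L_\phi$ is a linear bijection from $\mathcal{N}(V\times W)$ onto $\mathcal{L}_{\mathcal N}(V,W^*)$, and $\|(L_{\phi_{ij}})\|_{M_n(\mathcal{L}_{\mathcal N}(V,W^*))}=\|(\phi_{ij})\|_{M_n(\mathcal{N}(V\times W))}$ for every $n\in\mathbb{N}$ and every $(\phi_{ij})\in M_n(\mathcal{N}(V\times W))$. -/

import Mathlib

noncomputable section

set_option linter.unusedSectionVars false

open scoped TensorProduct Matrix.Norms.L2Operator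

namespace OpSp

/-! ### The operator norm of scalar matrices -/

section Scalar

variable {m n p q : Type*} [Fintype m] [DecidableEq m] [Fintype n] [DecidableEq n]
  [Fintype p] [DecidableEq p] [Fintype q] [DecidableEq q]

theorem l2_bound (A : Matrix m n ℂ) (x : n → ℂ) :
    ∑ i, ‖A.mulVec x i‖ ^ 2 ≤ ‖A‖ ^ 2 * ∑ j, ‖x j‖ ^ 2 := by
  have h := Matrix.l2_opNorm_mulVec A (WithLp.toLp 2 x)
  have h2 := pow_le_pow_left₀ (norm_nonneg _) h 2
  rw [mul_pow, EuclideanSpace.norm_sq_eq, EuclideanSpace.norm_sq_eq] at h2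
  simpa using h2

theorem l2_le {A : Matrix m n ℂ} {C : ℝ} (hC : 0 ≤ C)
    (h : ∀ x : n → ℂ, ∑ i, ‖A.mulVec x i‖ ^ 2 ≤ C ^ 2 * ∑ j, ‖x j‖ ^ 2) : ‖A‖ ≤ C := by
  rw [Matrix.l2_opNorm_def]
  refine ContinuousLinearMap.opNorm_le_bound _ hC fun x => ?_
  refine le_of_sq_le_sq ?_ (by positivity)
  rw [mul_pow, EuclideanSpace.norm_sq_eq, EuclideanSpace.norm_sq_eq]
  simpa using h (WithLp.ofLp x)

theorem l2_one_le : ‖(1 : Matrix n n ℂ)‖ ≤ 1 :=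
  l2_le zero_le_one fun x => by simp

theorem l2_inj_row (f : m → n) (hf : Function.Injective f) :
    ‖(1 : Matrix n n ℂ).submatrix f id‖ ≤ 1 := by
  refine l2_le zero_le_one fun x => ?_
  have : ∀ i, ((1 : Matrix n n ℂ).submatrix f id).mulVec x i = x (f i) := fun i => by
    simp [Matrix.mulVec, dotProduct, Matrix.one_apply]
  simp only [this, one_pow, one_mul]
  rw [← Finset.sum_image (s := Finset.univ) (g := f) (f := fun j => ‖x j‖ ^ 2)
    (fun a _ b _ h => hf h)]
  exact Finset.sum_le_sum_of_subset_of_nonneg (Finset.subset_univ _) fun _ _ _ => by positivity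

theorem l2_inj_col (f : m → n) (hf : Function.Injective f) :
    ‖(1 : Matrix n n ℂ).submatrix id f‖ ≤ 1 := by
  rw [← Matrix.l2_opNorm_conjTranspose]
  simpa [Matrix.conjTranspose_submatrix] using l2_inj_row f hf

theorem l2_fromBlocks_le (A : Matrix m n ℂ) (B : Matrix p q ℂ) :
    ‖Matrix.fromBlocks A 0 0 B‖ ≤ max ‖A‖ ‖B‖ := by
  refine l2_le (le_max_of_le_left (norm_nonneg _)) fun x => ?_
  have e : x = Sum.elim (fun i => x (Sum.inl i)) (fun i => x (Sum.inr i)) := by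
    ext i; cases i <;> rfl
  rw [e, Matrix.fromBlocks_mulVec]
  simp only [Fintype.sum_sum_type, Sum.elim_inl, Sum.elim_inr, Matrix.zero_mulVec, add_zero,
    zero_add, mul_add, Sum.elim_comp_inl, Sum.elim_comp_inr]
  refine add_le_add ((l2_bound A _).trans ?_) ((l2_bound B _).trans ?_)
  · gcongr; exact le_max_left _ _
  · gcongr; exact le_max_right _ _

open Matrix in
theorem l2_kron_one_le (A : Matrix m n ℂ) :
    ‖Matrix.kroneckerMap (fun a b : ℂ => a * b) A (1 : Matrix p p ℂ)‖ ≤ ‖A‖ := by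
  refine l2_le (norm_nonneg _) fun x => ?_
  have : ∀ i : m × p, (Matrix.kroneckerMap (fun a b : ℂ => a * b) A (1 : Matrix p p ℂ)).mulVec x i
      = A.mulVec (fun j => x (j, i.2)) i.1 := fun i => by
    simp [Matrix.mulVec, dotProduct, Fintype.sum_prod_type, Matrix.one_apply]
  simp only [this, Fintype.sum_prod_type_right]
  rw [Finset.mul_sum]
  exact Finset.sum_le_sum fun k _ => l2_bound A _

theorem l2_row_pair_le (s t : ℝ) :
    ‖(Matrix.of fun (i : n) (j : n ⊕ n) => Sum.elim (fun k => if i = k then (s : ℂ) else 0)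
      (fun k => if i = k then (t : ℂ) else 0) j : Matrix n (n ⊕ n) ℂ)‖ ≤ √(s ^ 2 + t ^ 2) := by
  refine l2_le (Real.sqrt_nonneg _) fun x => ?_
  rw [Real.sq_sqrt (by positivity)]
  simp only [Matrix.mulVec, dotProduct, Fintype.sum_sum_type, Matrix.of_apply, Sum.elim_inl,
    Sum.elim_inr, ite_mul, zero_mul, Finset.sum_ite_eq, Finset.mem_univ, if_true]
  rw [← Finset.sum_add_distrib, Finset.mul_sum]
  refine Finset.sum_le_sum fun i _ => ?_
  have h := norm_add_le ((s : ℂ) * x (Sum.inl i)) ((t : ℂ) * x (Sum.inr i))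
  simp only [norm_mul, Complex.norm_real, Real.norm_eq_abs] at h
  calc _ ≤ (|s| * ‖x (Sum.inl i)‖ + |t| * ‖x (Sum.inr i)‖) ^ 2 := by gcongr
    _ ≤ _ := by
      rw [← sq_abs s, ← sq_abs t]
      nlinarith [sq_nonneg (|s| * ‖x (Sum.inr i)‖ - |t| * ‖x (Sum.inl i)‖)]

end Scalar

section Core

/-- The matrix product `α v β` of a matrix `v` over a vector space `V` with scalar matrices
`α` and `β`. -/
def sandwich {V ι κ : Type*} [AddCommGroup V] [Module ℂ V] [Fintype ι]
    (α : Matrix κ ι ℂ) (v : Matrix ι ι V) (β : Matrix ι κ ℂ) : Matrix κ κ V :=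
  Matrix.of fun i j => ∑ k, ∑ l, (α i k * β l j) • v k l

/-- A matrix seminorm on a complex vector space `V`: a seminorm on the space `M_ι(V)` of
`ι × ι` matrices over `V` for every finite index set `ι` (for `ι = Fin n` this is `M_n(V)`),
subject to the axioms `M1` (direct sums) and `M2` (products with scalar matrices; `‖α‖` is the
operator norm between the `ℓ₂` spaces). By `M2` the seminorms do not change under a relabelling of
the index set, so the family is determined by its values on the `M_n(V)`, `n ∈ ℕ`. -/
structure MatrixSeminorm (V : Type*) [AddCommGroup V] [Module ℂ V] where
  toFun : ∀ {ι : Type} [Fintype ι], Matrix ι ι V → ℝ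
  add_le : ∀ {ι : Type} [Fintype ι] (v w : Matrix ι ι V), toFun (v + w) ≤ toFun v + toFun w
  smul : ∀ {ι : Type} [Fintype ι] (c : ℂ) (v : Matrix ι ι V), toFun (c • v) = ‖c‖ * toFun v
  M1 : ∀ {ι κ : Type} [Fintype ι] [Fintype κ] (v : Matrix ι ι V) (w : Matrix κ κ V),
    toFun (Matrix.fromBlocks v 0 0 w) = max (toFun v) (toFun w)
  M2 : ∀ {ι κ : Type} [Fintype ι] [DecidableEq ι] [Fintype κ] [DecidableEq κ]
    (α : Matrix κ ι ℂ) (v : Matrix ι ι V) (β : Matrix ι κ ℂ),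
    toFun (sandwich α v β) ≤ ‖α‖ * toFun v * ‖β‖

/-- A vector as a `1 × 1` matrix. -/
def unit {V : Type*} (v : V) : Matrix Unit Unit V := Matrix.of fun _ _ => v

/-- An operator space: a normed space together with matrix norms that satisfy the axioms `M1` and
`M2` and whose norm on `M_1(V) = V` is the given one. (If `V` is merely seminormed, this is an
operator space up to separation; it is used in this generality only on the way to completions.
If `V` is normed, then all the matrix seminorms are norms, since `‖v i j‖ ≤ ‖v‖` by `M2`.) -/
class OperatorSpace (V : Type*) [SeminormedAddCommGroup V] [NormedSpace ℂ V] where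
  toMatrixSeminorm : MatrixSeminorm V
  norm_unit : ∀ v : V, toMatrixSeminorm.toFun (unit v) = ‖v‖

/-- The norm of a matrix over an operator space. -/
def mnorm {V : Type*} [SeminormedAddCommGroup V] [NormedSpace ℂ V] [OperatorSpace V]
    {ι : Type} [Fintype ι] (v : Matrix ι ι V) : ℝ :=
  (OperatorSpace.toMatrixSeminorm (V := V)).toFun v

namespace MatrixSeminorm

variable {V : Type*} [AddCommGroup V] [Module ℂ V] (N : MatrixSeminorm V)
  {ι κ : Type} [Fintype ι] [Fintype κ]

theorem map_zero : N.toFun (0 : Matrix ι ι V) = 0 := by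
  simpa using N.smul (0 : ℂ) (0 : Matrix ι ι V)

theorem map_neg (v : Matrix ι ι V) : N.toFun (-v) = N.toFun v := by
  simpa using N.smul (-1 : ℂ) v

theorem nonneg (v : Matrix ι ι V) : 0 ≤ N.toFun v := by
  have := N.add_le v (-v)
  rw [add_neg_cancel, map_zero, map_neg] at this
  linarith

theorem submatrix_le (v : Matrix ι ι V) (f : κ → ι) (hf : Function.Injective f) :
    N.toFun (v.submatrix f f) ≤ N.toFun v := by
  classical
  have h := N.M2 ((1 : Matrix ι ι ℂ).submatrix f id) v ((1 : Matrix ι ι ℂ).submatrix id f)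
  have e : sandwich ((1 : Matrix ι ι ℂ).submatrix f id) v ((1 : Matrix ι ι ℂ).submatrix id f)
      = v.submatrix f f := by
    ext i j
    simp [sandwich, Matrix.one_apply]
  rw [e] at h
  calc _ ≤ _ := h
    _ ≤ 1 * N.toFun v * 1 := by
      have := N.nonneg v
      gcongr
      · exact l2_inj_row f hf
      · exact l2_inj_col f hf
    _ = _ := by ring

theorem submatrix_equiv (v : Matrix ι ι V) (e : κ ≃ ι) :
    N.toFun (v.submatrix e e) = N.toFun v := by
  refine le_antisymm (N.submatrix_le v e e.injective) ?_
  have := N.submatrix_le (v.submatrix e e) e.symm e.symm.injective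
  simpa using this

theorem entry_le (v : Matrix ι ι V) (i j : ι) : N.toFun (unit (v i j)) ≤ N.toFun v := by
  classical
  have h := N.M2 ((1 : Matrix ι ι ℂ).submatrix (fun _ : Unit => i) id) v
    ((1 : Matrix ι ι ℂ).submatrix id (fun _ : Unit => j))
  have e : sandwich ((1 : Matrix ι ι ℂ).submatrix (fun _ : Unit => i) id) v
    ((1 : Matrix ι ι ℂ).submatrix id (fun _ : Unit => j)) = unit (v i j) := by
    ext a b
    simp [sandwich, Matrix.one_apply, unit]
  rw [e] at h
  calc _ ≤ _ := h
    _ ≤ 1 * N.toFun v * 1 := by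
      have := N.nonneg v
      gcongr
      · exact l2_inj_row _ (fun _ _ _ => rfl)
      · exact l2_inj_col _ (fun _ _ _ => rfl)
    _ = _ := by ring

theorem single_le [DecidableEq ι] (i j : ι) (x : V) :
    N.toFun (Matrix.single i j x) ≤ N.toFun (unit x) := by
  have h := N.M2 ((1 : Matrix ι ι ℂ).submatrix id (fun _ : Unit => i)) (unit x)
    ((1 : Matrix ι ι ℂ).submatrix (fun _ : Unit => j) id)
  have e : sandwich ((1 : Matrix ι ι ℂ).submatrix id (fun _ : Unit => i)) (unit x)
    ((1 : Matrix ι ι ℂ).submatrix (fun _ : Unit => j) id) = Matrix.single i j x := by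
    ext a b
    simp only [sandwich, Matrix.one_apply, unit, Matrix.single_apply, Matrix.of_apply,
      Matrix.submatrix_apply, id, Finset.univ_unique, Finset.sum_singleton]
    by_cases h1 : a = i
    · by_cases h2 : j = b <;> simp [h1, h2]
    · simp [h1, Ne.symm h1]
  rw [e] at h
  calc _ ≤ _ := h
    _ ≤ 1 * N.toFun (unit x) * 1 := by
      have := N.nonneg (unit x)
      gcongr
      · exact l2_inj_col _ (fun _ _ _ => rfl)
      · exact l2_inj_row _ (fun _ _ _ => rfl)
    _ = _ := by ring

theorem sum_le {τ : Type*} (s : Finset τ) (f : τ → Matrix ι ι V) :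
    N.toFun (∑ t ∈ s, f t) ≤ ∑ t ∈ s, N.toFun (f t) := by
  classical
  induction s using Finset.induction_on with
  | empty => simp [map_zero]
  | insert a s ha ih =>
    rw [Finset.sum_insert ha, Finset.sum_insert ha]
    exact (N.add_le _ _).trans (by gcongr)

theorem le_sum (v : Matrix ι ι V) : N.toFun v ≤ ∑ i, ∑ j, N.toFun (unit (v i j)) := by
  classical
  conv_lhs => rw [Matrix.matrix_eq_sum_single v]
  refine (N.sum_le _ _).trans (Finset.sum_le_sum fun i _ => ?_)
  exact (N.sum_le _ _).trans (Finset.sum_le_sum fun j _ => N.single_le i j _)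

open Classical in
/-- The block diagonal matrix with blocks `x`. -/
def ampl (κ : Type) (x : Matrix ι ι V) : Matrix (κ × ι) (κ × ι) V :=
  Matrix.of fun a b => if a.1 = b.1 then x a.2 b.2 else 0

theorem ampl_le (x : Matrix ι ι V) (κ : Type) [Fintype κ] :
    N.toFun (ampl κ x) ≤ N.toFun x := by
  refine Fintype.induction_empty_option (P := fun κ _ => N.toFun (ampl κ x) ≤ N.toFun x)
    ?_ ?_ ?_ κ
  · intro α β _ e ih
    let _ : Fintype α := Fintype.ofEquiv β e.symm
    have h1 : ampl β x = (ampl α x).submatrix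
        (e.symm.prodCongr (Equiv.refl ι)) (e.symm.prodCongr (Equiv.refl ι)) := by
      ext a b
      by_cases h : a.1 = b.1 <;> simp [ampl, h]
    rw [h1, N.submatrix_equiv]
    exact ih
  · have : ampl PEmpty x = 0 := by
      ext a; exact a.1.elim
    rw [this, N.map_zero]; exact N.nonneg _
  · intro α _ ih
    let e : Option α × ι ≃ (α × ι) ⊕ ι :=
      ((Equiv.optionEquivSumPUnit.{0} α).prodCongr (Equiv.refl ι)).trans
        ((Equiv.sumProdDistrib α PUnit.{1} ι).trans
          ((Equiv.refl _).sumCongr (Equiv.punitProd ι)))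
    have h1 : ampl (Option α) x = (Matrix.fromBlocks (ampl α x) 0 0 x).submatrix e e := by
      ext ⟨a, i⟩ ⟨b, j⟩
      cases a with
      | none => cases b <;> simp [e, Equiv.optionEquivSumPUnit, ampl]
      | some a =>
        cases b with
        | none => simp [e, Equiv.optionEquivSumPUnit, ampl]
        | some b => by_cases h : a = b <;> simp [e, Equiv.optionEquivSumPUnit, ampl, h]
    rw [h1, N.submatrix_equiv, N.M1]
    exact max_le ih le_rfl

/-- Amplification by an identity matrix does not increase the norm. -/
theorem one_kron_le (x : Matrix ι ι V) (κ : Type) [Fintype κ] [DecidableEq κ] :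
    N.toFun (Matrix.kroneckerMap (fun (a : ℂ) (y : V) => a • y) (1 : Matrix κ κ ℂ) x)
      ≤ N.toFun x := by
  convert! N.ampl_le x κ using 2
  ext a b
  by_cases h : a.1 = b.1 <;> simp [ampl, h, Matrix.one_apply]

/-- The Kronecker product of a scalar matrix with a matrix over `V`. -/
theorem kron_le [DecidableEq κ] [DecidableEq ι] (a : Matrix κ κ ℂ) (x : Matrix ι ι V) :
    N.toFun (Matrix.kroneckerMap (fun (a : ℂ) (y : V) => a • y) a x) ≤ ‖a‖ * N.toFun x := by
  have e : Matrix.kroneckerMap (fun (a : ℂ) (y : V) => a • y) a x =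
      sandwich (Matrix.kroneckerMap (fun a b : ℂ => a * b) a (1 : Matrix ι ι ℂ))
        (Matrix.kroneckerMap (fun (a : ℂ) (y : V) => a • y) (1 : Matrix κ κ ℂ) x) 1 := by
    ext p q
    simp [sandwich, Matrix.one_apply, Fintype.sum_prod_type, Prod.ext_iff, ite_and,
      Finset.sum_ite_eq]
  rw [e]
  calc _ ≤ _ := N.M2 _ _ _
    _ ≤ ‖a‖ * N.toFun x * 1 := by
      have := N.nonneg x
      have := N.nonneg (Matrix.kroneckerMap (fun (a : ℂ) (y : V) => a • y) (1 : Matrix κ κ ℂ) x)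
      gcongr
      · exact l2_kron_one_le a
      · exact N.one_kron_le x κ
      · exact l2_one_le
    _ = _ := by ring

end MatrixSeminorm

end Core

section Instances

/-- The complex numbers as an operator space: `M_ι(ℂ)` carries the operator norm. -/
instance instOperatorSpaceComplex : OperatorSpace ℂ where
  toMatrixSeminorm :=
    { toFun := fun {ι} _ v => by classical exact ‖v‖
      add_le := fun v w => by classical exact norm_add_le v w
      smul := fun c v => by classical exact norm_smul c v
      M1 := fun {ι κ} _ _ v w => by
        classical
        have h0 : ∀ (ι : Type) [Fintype ι] (d1 d2 : DecidableEq ι) (v : Matrix ι ι ℂ),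
            @norm _ (@Matrix.instL2OpNormedAddCommGroup ℂ ι ι _ _ _ d1).toNorm v
            = @norm _ (@Matrix.instL2OpNormedAddCommGroup ℂ ι ι _ _ _ d2).toNorm v := by
          intro ι _ d1 d2 v
          rw [Subsingleton.elim d1 d2]
        have h2 : ∀ (z : Matrix (ι ⊕ κ) (ι ⊕ κ) ℂ) (τ : Type) [Fintype τ] [DecidableEq τ]
            (f : τ → ι ⊕ κ) (_ : Function.Injective f), ‖z.submatrix f f‖ ≤ ‖z‖ := by
          intro z τ _ _ f hf
          have e : z.submatrix f f = (1 : Matrix (ι ⊕ κ) (ι ⊕ κ) ℂ).submatrix f id * z *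
              (1 : Matrix (ι ⊕ κ) (ι ⊕ κ) ℂ).submatrix id f := by
            ext i j
            simp only [Matrix.mul_apply, Matrix.submatrix_apply, id, Matrix.one_apply, ite_mul,
              one_mul, zero_mul, mul_ite, mul_one, mul_zero, Finset.sum_ite_eq,
              Finset.sum_ite_eq', Finset.mem_univ, if_true]
          rw [e]
          calc _ ≤ _ := Matrix.l2_opNorm_mul _ _
            _ ≤ (‖(1 : Matrix (ι ⊕ κ) (ι ⊕ κ) ℂ).submatrix f id‖ * ‖z‖) * _ := by
              gcongr; exact Matrix.l2_opNorm_mul _ _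
            _ ≤ (1 * ‖z‖) * 1 := by
              gcongr
              · exact l2_inj_row f hf
              · exact l2_inj_col f hf
            _ = _ := by ring
        have h3 := h2 (Matrix.fromBlocks v 0 0 w) ι Sum.inl Sum.inl_injective
        have h4 := h2 (Matrix.fromBlocks v 0 0 w) κ Sum.inr Sum.inr_injective
        have h5 : (Matrix.fromBlocks v 0 0 w).submatrix Sum.inl Sum.inl = v := rfl
        have h6 : (Matrix.fromBlocks v 0 0 w).submatrix Sum.inr Sum.inr = w := rfl
        rw [h5] at h3
        rw [h6] at h4
        have h7 := le_antisymm (l2_fromBlocks_le v w) (max_le h3 h4)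
        convert! h7
      M2 := fun {ι κ} _ _ _ _ α v β => by
        have e : sandwich α v β = α * v * β := by
          ext i j
          simp only [sandwich, Matrix.of_apply, Matrix.mul_apply, smul_eq_mul, Finset.sum_mul]
          rw [Finset.sum_comm]
          exact Finset.sum_congr rfl fun _ _ => Finset.sum_congr rfl fun _ _ => by ring
        have h : ‖α * v * β‖ ≤ ‖α‖ * ‖v‖ * ‖β‖ := (Matrix.l2_opNorm_mul _ _).trans
          (by gcongr; exact Matrix.l2_opNorm_mul _ _)
        rw [e]
        convert! h }
  norm_unit := fun z => by
    classical
    have e : (unit z : Matrix Unit Unit ℂ) = Matrix.diagonal fun _ => z := by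
      ext i j; simp [unit]
    have h : ‖(unit z : Matrix Unit Unit ℂ)‖ = ‖z‖ := by
      rw [e, Matrix.l2_opNorm_diagonal]
      simp
    convert! h

theorem mnorm_complex {ι : Type} [Fintype ι] [DecidableEq ι] (v : Matrix ι ι ℂ) :
    mnorm v = ‖v‖ := by
  change @norm _ (@Matrix.instL2OpNormedAddCommGroup ℂ ι ι _ _ _ _).toNorm v = _
  congr!

end Instances

section Test

variable {L X B : Type*} [AddCommGroup L] [Module ℂ L] [AddCommGroup X] [Module ℂ X]
  (g : B → L →ₗ[ℂ] X) {ι κ τ : Type} [Fintype ι] [Fintype κ] [Fintype τ]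

/-- The matrix `(g (b k l) (Φ i j))`, indexed by the pairs `(i, k)`, `(j, l)`. -/
def km (Φ : Matrix κ κ L) (b : Matrix ι ι B) : Matrix (κ × ι) (κ × ι) X :=
  Matrix.kroneckerMap (fun l b => g b l) Φ b

theorem km_add (Φ Φ' : Matrix κ κ L) (b : Matrix ι ι B) :
    km g (Φ + Φ') b = km g Φ b + km g Φ' b := by
  ext p q; simp [km]

theorem km_smul (c : ℂ) (Φ : Matrix κ κ L) (b : Matrix ι ι B) :
    km g (c • Φ) b = c • km g Φ b := by
  ext p q; simp [km]

theorem km_sandwich [DecidableEq ι] (α : Matrix τ κ ℂ) (Φ : Matrix κ κ L) (β : Matrix κ τ ℂ)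
    (b : Matrix ι ι B) : km g (sandwich α Φ β) b =
      sandwich (Matrix.kroneckerMap (fun a b : ℂ => a * b) α (1 : Matrix ι ι ℂ)) (km g Φ b)
        (Matrix.kroneckerMap (fun a b : ℂ => a * b) β (1 : Matrix ι ι ℂ)) := by
  ext ⟨p, p'⟩ ⟨q, q'⟩
  simp [km, sandwich, Matrix.one_apply, Fintype.sum_prod_type, map_sum]

theorem km_fromBlocks (Φ : Matrix κ κ L) (Φ' : Matrix τ τ L) (b : Matrix ι ι B) :
    km g (Matrix.fromBlocks Φ 0 0 Φ') b = (Matrix.fromBlocks (km g Φ b) 0 0 (km g Φ' b)).submatrix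
      (Equiv.sumProdDistrib κ τ ι) (Equiv.sumProdDistrib κ τ ι) := by
  ext ⟨p, p'⟩ ⟨q, q'⟩
  cases p <;> cases q <;> simp [km]

variable (N : MatrixSeminorm X) {J : Type*} {idx : J → Type} [∀ j, Fintype (idx j)]
  (b : ∀ j, Matrix (idx j) (idx j) B) (r : J → ℝ)

/-- The bounds for a matrix of maps, tested on the matrices `b j`. -/
def testSet (Φ : Matrix κ κ L) : Set ℝ :=
  {C | 0 ≤ C ∧ ∀ j, N.toFun (km g Φ (b j)) ≤ C * r j}

theorem testSet_nonempty (hr : ∀ j, 0 ≤ r j)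
    (hne : ∀ l : L, ∃ C : ℝ, ∀ j, N.toFun ((b j).map (g · l)) ≤ C * r j)
    (Φ : Matrix κ κ L) : (testSet g N b r Φ).Nonempty := by
  classical
  choose C hC using hne
  refine ⟨∑ i, ∑ j, ‖(Matrix.single i j 1 : Matrix κ κ ℂ)‖ * |C (Φ i j)|,
    by positivity, fun t => ?_⟩
  have e : km g Φ (b t) = ∑ i, ∑ j, Matrix.kroneckerMap (fun (a : ℂ) (y : X) => a • y)
      (Matrix.single i j 1 : Matrix κ κ ℂ) ((b t).map (g · (Φ i j))) := by
    ext ⟨p, p'⟩ ⟨q, q'⟩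
    simp [km, Matrix.sum_apply, Matrix.single_apply, ite_and]
  rw [e, Finset.sum_mul]
  refine (N.sum_le _ _).trans (Finset.sum_le_sum fun i _ => ?_)
  rw [Finset.sum_mul]
  refine (N.sum_le _ _).trans (Finset.sum_le_sum fun j _ => ?_)
  refine (N.kron_le _ _).trans ?_
  rw [mul_assoc]
  gcongr
  exact (hC _ t).trans (mul_le_mul_of_nonneg_right (le_abs_self _) (hr t))

theorem testSet_bddBelow (Φ : Matrix κ κ L) : BddBelow (testSet g N b r Φ) :=
  ⟨0, fun _ h => h.1⟩

theorem test_sInf_mem (hr : ∀ j, 0 ≤ r j)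
    (hne : ∀ l : L, ∃ C : ℝ, ∀ j, N.toFun ((b j).map (g · l)) ≤ C * r j)
    (Φ : Matrix κ κ L) :
    sInf (testSet g N b r Φ) ∈ testSet g N b r Φ := by
  have h := testSet_nonempty g N b r hr hne Φ
  refine ⟨le_csInf h fun _ h => h.1, fun j => ?_⟩
  rcases (hr j).eq_or_lt with h0 | h0
  · obtain ⟨C, hC⟩ := h
    have := hC.2 j
    rw [← h0] at this ⊢
    simpa using this
  · rw [← div_le_iff₀ h0]
    exact le_csInf h fun C hC => (div_le_iff₀ h0).2 (hC.2 j)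

/-- The matrix seminorm given by the best bound on a family of test matrices. -/
def testSeminorm (hr : ∀ j, 0 ≤ r j)
    (hne : ∀ l : L, ∃ C : ℝ, ∀ j, N.toFun ((b j).map (g · l)) ≤ C * r j) :
    MatrixSeminorm L where
  toFun := fun Φ => sInf (testSet g N b r Φ)
  add_le := fun Φ Ψ => by
    have h1 := test_sInf_mem g N b r hr hne Φ
    have h2 := test_sInf_mem g N b r hr hne Ψ
    refine csInf_le (testSet_bddBelow g N b r _) ⟨add_nonneg h1.1 h2.1, fun j => ?_⟩
    rw [km_add, add_mul]
    exact (N.add_le _ _).trans (add_le_add (h1.2 j) (h2.2 j))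
  smul := by
    intro κ _ c Φ
    have key : ∀ (c : ℂ) (Φ : Matrix κ κ L),
        sInf (testSet g N b r (c • Φ)) ≤ ‖c‖ * sInf (testSet g N b r Φ) := fun c Φ => by
      have h1 := test_sInf_mem g N b r hr hne Φ
      refine csInf_le (testSet_bddBelow g N b r _) ⟨mul_nonneg (norm_nonneg _) h1.1, fun j => ?_⟩
      rw [km_smul, N.smul, mul_assoc]
      exact mul_le_mul_of_nonneg_left (h1.2 j) (norm_nonneg _)
    refine le_antisymm (key c Φ) ?_
    by_cases hc : c = 0
    · subst hc
      simpa using (test_sInf_mem g N b r hr hne ((0 : ℂ) • Φ)).1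
    · have := key c⁻¹ (c • Φ)
      rw [smul_smul, inv_mul_cancel₀ hc, one_smul, norm_inv] at this
      have hc' : 0 < ‖c‖ := norm_pos_iff.2 hc
      calc _ ≤ ‖c‖ * (‖c‖⁻¹ * sInf (testSet g N b r (c • Φ))) := by gcongr
        _ = _ := by field_simp
  M1 := by
    intro ι κ _ _ Φ Ψ
    have h1 := test_sInf_mem g N b r hr hne Φ
    have h2 := test_sInf_mem g N b r hr hne Ψ
    have h3 := test_sInf_mem g N b r hr hne (Matrix.fromBlocks Φ 0 0 Ψ)
    have e : ∀ j, N.toFun (km g (Matrix.fromBlocks Φ 0 0 Ψ) (b j))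
        = max (N.toFun (km g Φ (b j))) (N.toFun (km g Ψ (b j))) := fun j => by
      rw [km_fromBlocks, N.submatrix_equiv, N.M1]
    refine le_antisymm ?_ (max_le ?_ ?_)
    · refine csInf_le (testSet_bddBelow g N b r _) ⟨le_max_of_le_left h1.1, fun j => ?_⟩
      rw [e]
      refine max_le ((h1.2 j).trans ?_) ((h2.2 j).trans ?_)
      · exact mul_le_mul_of_nonneg_right (le_max_left _ _) (hr j)
      · exact mul_le_mul_of_nonneg_right (le_max_right _ _) (hr j)
    · exact csInf_le (testSet_bddBelow g N b r _)
        ⟨h3.1, fun j => (le_max_left _ _).trans ((e j).symm.le.trans (h3.2 j))⟩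
    · exact csInf_le (testSet_bddBelow g N b r _)
        ⟨h3.1, fun j => (le_max_right _ _).trans ((e j).symm.le.trans (h3.2 j))⟩
  M2 := by
    classical
    intro ι κ _ _ _ _ α Φ β
    have h1 := test_sInf_mem g N b r hr hne Φ
    refine csInf_le (testSet_bddBelow g N b r _)
      ⟨mul_nonneg (mul_nonneg (norm_nonneg _) h1.1) (norm_nonneg _), fun j => ?_⟩
    rw [km_sandwich]
    calc _ ≤ _ := N.M2 _ _ _
      _ ≤ ‖α‖ * (sInf (testSet g N b r Φ) * r j) * ‖β‖ := by
        have h2 := N.nonneg (km g Φ (b j))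
        have h3 := l2_kron_one_le (p := idx j) α
        have h4 := l2_kron_one_le (p := idx j) β
        exact mul_le_mul (mul_le_mul h3 (h1.2 j) h2 (norm_nonneg _)) h4 (norm_nonneg _)
          (mul_nonneg (norm_nonneg _) (h2.trans (h1.2 j)))
      _ = _ := by ring

end Test

section Norms

variable {L : Type*} [AddCommGroup L] [Module ℂ L] (N : MatrixSeminorm L)

/-- The seminorm of `M_1(L) = L`. -/
abbrev MatrixSeminorm.toSeminormed : SeminormedAddCommGroup L :=
  AddGroupSeminorm.toSeminormedAddCommGroup
    { toFun := fun v => N.toFun (unit v)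
      map_zero' := N.map_zero
      add_le' := fun v w => N.add_le (unit v) (unit w)
      neg' := fun v => N.map_neg (unit v) }

/-- The norm of `M_1(L) = L`. -/
abbrev MatrixSeminorm.toNormed (h : ∀ v, N.toFun (unit v) = 0 → v = 0) : NormedAddCommGroup L :=
  AddGroupNorm.toNormedAddCommGroup
    { toFun := fun v => N.toFun (unit v)
      map_zero' := N.map_zero
      add_le' := fun v w => N.add_le (unit v) (unit w)
      neg' := fun v => N.map_neg (unit v)
      eq_zero_of_map_eq_zero' := h }

variable {V : Type*} [SeminormedAddCommGroup V] [NormedSpace ℂ V] [OperatorSpace V]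
  {ι κ : Type} [Fintype ι] [Fintype κ]

theorem mnorm_nonneg (v : Matrix ι ι V) : 0 ≤ mnorm v := MatrixSeminorm.nonneg _ v

theorem mnorm_unit (v : V) : mnorm (unit v) = ‖v‖ := OperatorSpace.norm_unit v

theorem norm_entry_le (v : Matrix ι ι V) (i j : ι) : ‖v i j‖ ≤ mnorm v := by
  rw [← mnorm_unit]; exact MatrixSeminorm.entry_le _ v i j

theorem mnorm_le_sum (v : Matrix ι ι V) : mnorm v ≤ ∑ i, ∑ j, ‖v i j‖ := by
  simp only [← mnorm_unit]; exact MatrixSeminorm.le_sum _ v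

theorem mnorm_submatrix_equiv (v : Matrix ι ι V) (e : κ ≃ ι) :
    mnorm (v.submatrix e e) = mnorm v := MatrixSeminorm.submatrix_equiv _ v e

theorem mnorm_submatrix_le (v : Matrix ι ι V) (f : κ → ι) (hf : Function.Injective f) :
    mnorm (v.submatrix f f) ≤ mnorm v := MatrixSeminorm.submatrix_le _ v f hf

theorem mnorm_add_le (v w : Matrix ι ι V) : mnorm (v + w) ≤ mnorm v + mnorm w :=
  MatrixSeminorm.add_le _ v w

theorem mnorm_smul (c : ℂ) (v : Matrix ι ι V) : mnorm (c • v) = ‖c‖ * mnorm v :=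
  MatrixSeminorm.smul _ c v

theorem mnorm_zero : mnorm (0 : Matrix ι ι V) = 0 :=
  MatrixSeminorm.map_zero _

theorem mnorm_neg (v : Matrix ι ι V) : mnorm (-v) = mnorm v := MatrixSeminorm.map_neg _ v

theorem mnorm_fromBlocks (v : Matrix ι ι V) (w : Matrix κ κ V) :
    mnorm (Matrix.fromBlocks v 0 0 w) = max (mnorm v) (mnorm w) :=
  MatrixSeminorm.M1 _ v w

theorem mnorm_sandwich_le [DecidableEq ι] [DecidableEq κ] (α : Matrix κ ι ℂ) (v : Matrix ι ι V)
    (β : Matrix ι κ ℂ) : mnorm (sandwich α v β) ≤ ‖α‖ * mnorm v * ‖β‖ :=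
  MatrixSeminorm.M2 _ α v β

theorem mnorm_sub_le (v w : Matrix ι ι V) : |mnorm v - mnorm w| ≤ mnorm (v - w) := by
  have h1 := (OperatorSpace.toMatrixSeminorm (V := V)).add_le (v - w) w
  have h2 := (OperatorSpace.toMatrixSeminorm (V := V)).add_le (-(v - w)) v
  rw [MatrixSeminorm.map_neg] at h2
  rw [abs_le]
  have e1 : v - w + w = v := by abel
  have e2 : -(v - w) + v = w := by abel
  rw [e1] at h1
  rw [e2] at h2
  change mnorm v ≤ mnorm (v - w) + mnorm w at h1
  change mnorm w ≤ mnorm (v - w) + mnorm v at h2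
  constructor <;> linarith

theorem uniformContinuous_mnorm : UniformContinuous (mnorm : Matrix ι ι V → ℝ) := by
  have h : LipschitzWith (Fintype.card ι * Fintype.card ι)
      (fun v : ι → ι → V => mnorm (Matrix.of v)) := by
    refine LipschitzWith.of_dist_le_mul fun v w => ?_
    rw [Real.dist_eq]
    refine (mnorm_sub_le _ _).trans ((mnorm_le_sum _).trans ?_)
    calc _ ≤ ∑ _i : ι, ∑ _j : ι, dist v w := by
          refine Finset.sum_le_sum fun i _ => Finset.sum_le_sum fun j _ => ?_
          have h1 := dist_le_pi_dist v w i
          have h2 := dist_le_pi_dist (v i) (w i) j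
          rw [dist_eq_norm] at h2
          exact h2.trans h1
      _ = _ := by simp [mul_assoc]
  exact h.uniformContinuous

end Norms

section CB

variable (V W X : Type*) [NormedAddCommGroup V] [NormedSpace ℂ V] [OperatorSpace V]
  [NormedAddCommGroup W] [NormedSpace ℂ W] [OperatorSpace W]
  [NormedAddCommGroup X] [NormedSpace ℂ X] [OperatorSpace X]

/-- A linear map is completely bounded if its amplifications `M_n(V) → M_n(X)` are uniformly
bounded. -/
def IsCB {V X : Type*} [NormedAddCommGroup V] [NormedSpace ℂ V] [OperatorSpace V]
    [NormedAddCommGroup X] [NormedSpace ℂ X] [OperatorSpace X] (φ : V →ₗ[ℂ] X) : Prop :=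
  ∃ C : ℝ, ∀ (n : ℕ) (v : Matrix (Fin n) (Fin n) V), mnorm (v.map φ) ≤ C * mnorm v

/-- The completely bounded linear maps. -/
def cbSubmodule : Submodule ℂ (V →ₗ[ℂ] X) where
  carrier := {φ | IsCB φ}
  add_mem' := by
    rintro φ ψ ⟨C, hC⟩ ⟨D, hD⟩
    refine ⟨C + D, fun n v => ?_⟩
    have e : v.map (φ + ψ) = v.map φ + v.map ψ := by ext; simp
    rw [e, add_mul]
    exact (mnorm_add_le _ _).trans (add_le_add (hC n v) (hD n v))
  zero_mem' := ⟨0, fun n v => by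
    have e : v.map (0 : V →ₗ[ℂ] X) = 0 := by ext; simp
    rw [e, mnorm_zero]; simp⟩
  smul_mem' := by
    rintro c φ ⟨C, hC⟩
    refine ⟨‖c‖ * C, fun n v => ?_⟩
    have e : v.map (c • φ) = c • v.map φ := by ext; simp
    rw [e, mnorm_smul, mul_assoc]
    exact mul_le_mul_of_nonneg_left (hC n v) (norm_nonneg _)

/-- The space `CB(V, X)` of completely bounded linear maps. -/
def CB : Type _ := cbSubmodule V X

namespace CB

instance : AddCommGroup (CB V X) := inferInstanceAs (AddCommGroup (cbSubmodule V X))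
instance : Module ℂ (CB V X) := inferInstanceAs (Module ℂ (cbSubmodule V X))

variable {V X}

/-- A linear map with a proof that it is completely bounded. -/
def mk (φ : V →ₗ[ℂ] X) (h : IsCB φ) : CB V X := ⟨φ, h⟩

instance : FunLike (CB V X) V X where
  coe φ := φ.1
  coe_injective _ _ h := Subtype.ext (DFunLike.coe_injective h)

instance : LinearMapClass (CB V X) ℂ V X where
  map_add φ := φ.1.map_add
  map_smulₛₗ φ := φ.1.map_smul

@[ext] theorem ext {φ ψ : CB V X} (h : ∀ v, φ v = ψ v) : φ = ψ := DFunLike.ext _ _ h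

@[simp] theorem mk_apply (φ : V →ₗ[ℂ] X) (h : IsCB φ) (v : V) : mk φ h v = φ v := rfl
@[simp] theorem add_apply (φ ψ : CB V X) (v : V) : (φ + ψ) v = φ v + ψ v := rfl
@[simp] theorem smul_apply (c : ℂ) (φ : CB V X) (v : V) : (c • φ) v = c • φ v := rfl
@[simp] theorem zero_apply (v : V) : (0 : CB V X) v = 0 := rfl
@[simp] theorem sub_apply (φ ψ : CB V X) (v : V) : (φ - ψ) v = φ v - ψ v := rfl
/-- The norm of a matrix `Φ` of completely bounded maps: the completely bounded norm of the map
`V → M_κ(X)`, `v ↦ (Φ i j v)`, i.e. the supremum of the norms of its amplifications, written as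
the least common bound. -/
def matrixNorm {κ : Type} [Fintype κ] (Φ : Matrix κ κ (CB V X)) : ℝ :=
  sInf {C : ℝ | 0 ≤ C ∧ ∀ (n : ℕ) (v : Matrix (Fin n) (Fin n) V),
    mnorm (Matrix.kroneckerMap (fun (φ : CB V X) (v : V) => φ v) Φ v) ≤ C * mnorm v}

/-- Evaluation at a vector. -/
def ev (v : V) : CB V X →ₗ[ℂ] X where
  toFun φ := φ v
  map_add' _ _ := rfl
  map_smul' _ _ := rfl

/-- `matrixNorm` as a seminorm given by test matrices. -/
def testS : MatrixSeminorm (CB V X) :=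
  testSeminorm (J := Σ n, Matrix (Fin n) (Fin n) V) (idx := fun j => Fin j.1) (ev (X := X))
    (OperatorSpace.toMatrixSeminorm (V := X)) (fun j => j.2) (fun j => mnorm j.2)
    (fun _ => mnorm_nonneg _) (fun l => by
      obtain ⟨C, hC⟩ := l.2
      exact ⟨C, fun j => hC j.1 j.2⟩)

theorem matrixNorm_eq {κ : Type} [Fintype κ] (Φ : Matrix κ κ (CB V X)) :
    matrixNorm Φ = (testS (V := V) (X := X)).toFun Φ := by
  unfold matrixNorm testS testSeminorm testSet
  congr 1
  ext C
  simp only [Set.mem_ofPred_eq, Sigma.forall]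
  rfl

variable (V X) in
/-- The matrix norm of `CB(V, X)`. -/
def matrixSeminorm : MatrixSeminorm (CB V X) where
  toFun := matrixNorm
  add_le v w := by simpa only [matrixNorm_eq] using testS.add_le v w
  smul c v := by simpa only [matrixNorm_eq] using testS.smul c v
  M1 v w := by simpa only [matrixNorm_eq] using testS.M1 v w
  M2 a v b := by simpa only [matrixNorm_eq] using testS.M2 a v b

theorem matrixNorm_bound_fin {κ : Type} [Fintype κ] (Φ : Matrix κ κ (CB V X)) (n : ℕ)
    (v : Matrix (Fin n) (Fin n) V) :
    mnorm (Matrix.kroneckerMap (fun (φ : CB V X) (v : V) => φ v) Φ v)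
      ≤ matrixNorm Φ * mnorm v := by
  rw [matrixNorm_eq]
  exact (test_sInf_mem (J := Σ n, Matrix (Fin n) (Fin n) V) (idx := fun j => Fin j.1)
    (ev (X := X))
    (OperatorSpace.toMatrixSeminorm (V := X)) (fun j => j.2) (fun j => mnorm j.2)
    (fun _ => mnorm_nonneg _) (fun l => by
      obtain ⟨C, hC⟩ := l.2
      exact ⟨C, fun j => hC j.1 j.2⟩) Φ).2 ⟨n, v⟩

theorem matrixNorm_bound {κ ι : Type} [Fintype κ] [Fintype ι] (Φ : Matrix κ κ (CB V X))
    (v : Matrix ι ι V) :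
    mnorm (Matrix.kroneckerMap (fun (φ : CB V X) (v : V) => φ v) Φ v)
      ≤ matrixNorm Φ * mnorm v := by
  have e := Fintype.equivFin ι
  have h := matrixNorm_bound_fin Φ _ (v.submatrix e.symm e.symm)
  rw [mnorm_submatrix_equiv] at h
  have h2 : Matrix.kroneckerMap (fun (φ : CB V X) (v : V) => φ v) Φ (v.submatrix e.symm e.symm)
      = (Matrix.kroneckerMap (fun (φ : CB V X) (v : V) => φ v) Φ v).submatrix
        ((Equiv.refl κ).prodCongr e.symm) ((Equiv.refl κ).prodCongr e.symm) := rfl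
  rwa [h2, mnorm_submatrix_equiv] at h

theorem norm_bound (φ : CB V X) (v : V) : ‖φ v‖ ≤ matrixNorm (unit φ) * ‖v‖ := by
  have h := matrixNorm_bound (unit φ) (unit v)
  rw [mnorm_unit] at h
  exact (norm_entry_le _ ((), ()) ((), ())).trans h

instance : NormedAddCommGroup (CB V X) :=
  (matrixSeminorm V X).toNormed fun φ h => by
    ext v
    have := norm_bound φ v
    change matrixNorm (unit φ) = 0 at h
    rw [h, zero_mul] at this
    simpa using this

instance : NormedSpace ℂ (CB V X) where
  norm_smul_le c φ := ((matrixSeminorm V X).smul c (unit φ)).le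

/-- `CB(V, X)` is an operator space through `M_κ(CB(V, X)) = CB(V, M_κ(X))`. -/
instance : OperatorSpace (CB V X) where
  toMatrixSeminorm := matrixSeminorm V X
  norm_unit _ := rfl

theorem mnorm_def {κ : Type} [Fintype κ] (Φ : Matrix κ κ (CB V X)) : mnorm Φ = matrixNorm Φ := rfl

end CB

/-- The dual operator space `V* = CB(V, ℂ)`. -/
abbrev Dual : Type _ := CB V ℂ

end CB

section JCB

variable (V W X : Type*) [NormedAddCommGroup V] [NormedSpace ℂ V] [OperatorSpace V]
  [NormedAddCommGroup W] [NormedSpace ℂ W] [OperatorSpace W]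
  [NormedAddCommGroup X] [NormedSpace ℂ X] [OperatorSpace X]

/-- A bilinear map `φ` is jointly completely bounded if its amplifications
`M_n(V) × M_n(W) → M_{n × n}(X)`, `(v, w) ↦ (φ (v i j) (w k l))`, are uniformly bounded. -/
def IsJCB {V W X : Type*} [NormedAddCommGroup V] [NormedSpace ℂ V] [OperatorSpace V]
    [NormedAddCommGroup W] [NormedSpace ℂ W] [OperatorSpace W]
    [NormedAddCommGroup X] [NormedSpace ℂ X] [OperatorSpace X]
    (φ : V →ₗ[ℂ] W →ₗ[ℂ] X) : Prop :=
  ∃ C : ℝ, ∀ (n : ℕ) (v : Matrix (Fin n) (Fin n) V) (w : Matrix (Fin n) (Fin n) W),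
    mnorm (Matrix.kroneckerMap (fun v w => φ v w) v w) ≤ C * (mnorm v * mnorm w)

/-- The jointly completely bounded bilinear maps. -/
def jcbSubmodule : Submodule ℂ (V →ₗ[ℂ] W →ₗ[ℂ] X) where
  carrier := {φ | IsJCB φ}
  add_mem' := by
    rintro φ ψ ⟨C, hC⟩ ⟨D, hD⟩
    refine ⟨C + D, fun n v w => ?_⟩
    have e : Matrix.kroneckerMap (fun v w => (φ + ψ) v w) v w =
      Matrix.kroneckerMap (fun v w => φ v w) v w +
        Matrix.kroneckerMap (fun v w => ψ v w) v w := by ext; simp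
    rw [e, add_mul]
    exact (mnorm_add_le _ _).trans (add_le_add (hC n v w) (hD n v w))
  zero_mem' := ⟨0, fun n v w => by
    have e : Matrix.kroneckerMap (fun v w => (0 : V →ₗ[ℂ] W →ₗ[ℂ] X) v w) v w = 0 := by
      ext; simp
    rw [e, mnorm_zero]; simp⟩
  smul_mem' := by
    rintro c φ ⟨C, hC⟩
    refine ⟨‖c‖ * C, fun n v w => ?_⟩
    have e : Matrix.kroneckerMap (fun v w => (c • φ) v w) v w =
      c • Matrix.kroneckerMap (fun v w => φ v w) v w := by ext; simp
    rw [e, mnorm_smul, mul_assoc]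
    exact mul_le_mul_of_nonneg_left (hC n v w) (norm_nonneg _)

/-- The space `JCB(V × W, X)` of jointly completely bounded bilinear maps. -/
def JCB : Type _ := jcbSubmodule V W X

namespace JCB

instance : AddCommGroup (JCB V W X) := inferInstanceAs (AddCommGroup (jcbSubmodule V W X))
instance : Module ℂ (JCB V W X) := inferInstanceAs (Module ℂ (jcbSubmodule V W X))

variable {V W X}

/-- A bilinear map with a proof that it is jointly completely bounded. -/
def mk (φ : V →ₗ[ℂ] W →ₗ[ℂ] X) (h : IsJCB φ) : JCB V W X := ⟨φ, h⟩

/-- A jointly completely bounded bilinear map as a bilinear map. -/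
def toBilin (φ : JCB V W X) : V →ₗ[ℂ] W →ₗ[ℂ] X := φ.1

instance : CoeFun (JCB V W X) (fun _ => V → W → X) where
  coe φ := fun v w => φ.toBilin v w

@[ext] theorem ext {φ ψ : JCB V W X} (h : ∀ v w, φ v w = ψ v w) : φ = ψ :=
  Subtype.ext (LinearMap.ext₂ h)

@[simp] theorem mk_apply (φ : V →ₗ[ℂ] W →ₗ[ℂ] X) (h : IsJCB φ) (v : V) (w : W) :
    mk φ h v w = φ v w := rfl
@[simp] theorem add_apply (φ ψ : JCB V W X) (v : V) (w : W) : (φ + ψ) v w = φ v w + ψ v w := rfl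
@[simp] theorem smul_apply (c : ℂ) (φ : JCB V W X) (v : V) (w : W) :
    (c • φ) v w = c • φ v w := rfl
@[simp] theorem zero_apply (v : V) (w : W) : (0 : JCB V W X) v w = 0 := rfl
@[simp] theorem sub_apply (φ ψ : JCB V W X) (v : V) (w : W) : (φ - ψ) v w = φ v w - ψ v w := rfl

/-- The matrix `(Φ i j (v k l) (w s t))`, indexed by the triples `(i, (k, s))`,
`(j, (l, t))`. -/
def amp {κ ι τ : Type} (Φ : Matrix κ κ (JCB V W X)) (v : Matrix ι ι V) (w : Matrix τ τ W) :
    Matrix (κ × (ι × τ)) (κ × (ι × τ)) X :=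
  Matrix.kroneckerMap (fun (φ : JCB V W X) (p : V × W) => φ p.1 p.2) Φ
    (Matrix.kroneckerMap Prod.mk v w)

/-- The norm of a matrix `Φ` of jointly completely bounded maps: the jointly completely bounded
norm of the map `V × W → M_κ(X)`, `(v, w) ↦ (Φ i j v w)`, i.e. the supremum of the norms of its
amplifications, written as the least common bound. -/
def matrixNorm {κ : Type} [Fintype κ] (Φ : Matrix κ κ (JCB V W X)) : ℝ :=
  sInf {C : ℝ | 0 ≤ C ∧ ∀ (n : ℕ) (v : Matrix (Fin n) (Fin n) V) (w : Matrix (Fin n) (Fin n) W),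
    mnorm (amp Φ v w) ≤ C * (mnorm v * mnorm w)}

/-- Evaluation at a pair of vectors. -/
def ev (p : V × W) : JCB V W X →ₗ[ℂ] X where
  toFun φ := φ p.1 p.2
  map_add' _ _ := rfl
  map_smul' _ _ := rfl

theorem test_aux (l : JCB V W X) : ∃ C : ℝ,
    ∀ j : (Σ n, Matrix (Fin n) (Fin n) V × Matrix (Fin n) (Fin n) W),
    (OperatorSpace.toMatrixSeminorm (V := X)).toFun
      ((Matrix.kroneckerMap Prod.mk j.2.1 j.2.2).map (ev (X := X) · l)) ≤
      C * (mnorm j.2.1 * mnorm j.2.2) := by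
  obtain ⟨C, hC⟩ := l.2
  exact ⟨C, fun j => hC j.1 j.2.1 j.2.2⟩

/-- `matrixNorm` as a seminorm given by test matrices. -/
def testS : MatrixSeminorm (JCB V W X) :=
  testSeminorm (J := Σ n, Matrix (Fin n) (Fin n) V × Matrix (Fin n) (Fin n) W)
    (idx := fun j => Fin j.1 × Fin j.1) (ev (X := X))
    (OperatorSpace.toMatrixSeminorm (V := X)) (fun j => Matrix.kroneckerMap Prod.mk j.2.1 j.2.2)
    (fun j => mnorm j.2.1 * mnorm j.2.2)
    (fun _ => mul_nonneg (mnorm_nonneg _) (mnorm_nonneg _)) test_aux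

theorem matrixNorm_eq {κ : Type} [Fintype κ] (Φ : Matrix κ κ (JCB V W X)) :
    matrixNorm Φ = (testS (V := V) (W := W) (X := X)).toFun Φ := by
  unfold matrixNorm testS testSeminorm testSet
  congr 1
  ext C
  simp only [Set.mem_ofPred_eq, Sigma.forall, Prod.forall]
  rfl

variable (V W X) in
/-- The matrix norm of `JCB(V × W, X)`. -/
def matrixSeminorm : MatrixSeminorm (JCB V W X) where
  toFun := matrixNorm
  add_le v w := by simpa only [matrixNorm_eq] using testS.add_le v w
  smul c v := by simpa only [matrixNorm_eq] using testS.smul c v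
  M1 v w := by simpa only [matrixNorm_eq] using testS.M1 v w
  M2 a v b := by simpa only [matrixNorm_eq] using testS.M2 a v b

theorem matrixNorm_bound_fin {κ : Type} [Fintype κ] (Φ : Matrix κ κ (JCB V W X)) (n : ℕ)
    (v : Matrix (Fin n) (Fin n) V) (w : Matrix (Fin n) (Fin n) W) :
    mnorm (amp Φ v w) ≤ matrixNorm Φ * (mnorm v * mnorm w) := by
  rw [matrixNorm_eq]
  exact (test_sInf_mem (J := Σ n, Matrix (Fin n) (Fin n) V × Matrix (Fin n) (Fin n) W)
    (idx := fun j => Fin j.1 × Fin j.1) (ev (X := X))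
    (OperatorSpace.toMatrixSeminorm (V := X)) (fun j => Matrix.kroneckerMap Prod.mk j.2.1 j.2.2)
    (fun j => mnorm j.2.1 * mnorm j.2.2)
    (fun _ => mul_nonneg (mnorm_nonneg _) (mnorm_nonneg _)) test_aux Φ).2 ⟨n, v, w⟩

/-- The bound for test matrices of arbitrary, possibly different, sizes. -/
theorem matrixNorm_bound {κ ι τ : Type} [Fintype κ] [Fintype ι] [Fintype τ]
    (Φ : Matrix κ κ (JCB V W X)) (v : Matrix ι ι V) (w : Matrix τ τ W) :
    mnorm (amp Φ v w) ≤ matrixNorm Φ * (mnorm v * mnorm w) := by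
  have e := Fintype.equivFin (ι ⊕ τ)
  have h := matrixNorm_bound_fin Φ _ ((Matrix.fromBlocks v 0 0 0).submatrix e.symm e.symm)
    ((Matrix.fromBlocks 0 0 0 w).submatrix e.symm e.symm)
  rw [mnorm_submatrix_equiv, mnorm_submatrix_equiv, mnorm_fromBlocks, mnorm_fromBlocks,
    mnorm_zero, mnorm_zero, max_eq_left (mnorm_nonneg v), max_eq_right (mnorm_nonneg w)] at h
  refine le_trans ?_ h
  refine le_trans (le_of_eq ?_) (mnorm_submatrix_le _
    (fun p : κ × (ι × τ) => ((p.1, (e (Sum.inl p.2.1), e (Sum.inr p.2.2))) : κ × (_ × _))) ?_)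
  · congr 1
    ext p q
    simp [amp]
  · rintro ⟨a, b, c⟩ ⟨a', b', c'⟩ h
    simpa using h

theorem norm_bound (φ : JCB V W X) (v : V) (w : W) :
    ‖φ v w‖ ≤ matrixNorm (unit φ) * (‖v‖ * ‖w‖) := by
  have h := matrixNorm_bound (unit φ) (unit v) (unit w)
  rw [mnorm_unit, mnorm_unit] at h
  exact (norm_entry_le _ ((), ((), ())) ((), ((), ()))).trans h

instance : NormedAddCommGroup (JCB V W X) :=
  (matrixSeminorm V W X).toNormed fun φ h => by
    ext v w
    have := norm_bound φ v w
    change matrixNorm (unit φ) = 0 at h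
    rw [h, zero_mul] at this
    simpa using this

instance : NormedSpace ℂ (JCB V W X) where
  norm_smul_le c φ := ((matrixSeminorm V W X).smul c (unit φ)).le

/-- `JCB(V × W, X)` is an operator space through `M_κ(JCB(V × W, X)) = JCB(V × W, M_κ(X))`. -/
instance : OperatorSpace (JCB V W X) where
  toMatrixSeminorm := matrixSeminorm V W X
  norm_unit _ := rfl

end JCB

end JCB

section Complete

open Filter Topology

variable {V W X : Type*} [NormedAddCommGroup V] [NormedSpace ℂ V] [OperatorSpace V]
  [NormedAddCommGroup W] [NormedSpace ℂ W] [OperatorSpace W]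
  [NormedAddCommGroup X] [NormedSpace ℂ X] [OperatorSpace X]

namespace CB

theorem map_bound (φ : CB V X) {ι : Type} [Fintype ι] (v : Matrix ι ι V) :
    mnorm (v.map φ) ≤ ‖φ‖ * mnorm v := by
  refine le_trans (le_of_eq ?_) (matrixNorm_bound (unit φ) v)
  rw [← mnorm_submatrix_equiv _ (Equiv.punitProd ι).symm]
  rfl

theorem norm_le {φ : CB V X} {C : ℝ} (hC : 0 ≤ C)
    (h : ∀ (n : ℕ) (v : Matrix (Fin n) (Fin n) V), mnorm (v.map φ) ≤ C * mnorm v) : ‖φ‖ ≤ C := by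
  refine csInf_le ⟨0, fun _ h => h.1⟩ ⟨hC, fun n v => ?_⟩
  refine le_trans (le_of_eq ?_) (h n v)
  rw [← mnorm_submatrix_equiv _ (Equiv.punitProd (Fin n)).symm]
  rfl

instance [CompleteSpace X] : CompleteSpace (CB V X) := by
  refine Metric.complete_of_cauchySeq_tendsto fun u hu => ?_
  have hC : ∀ v, CauchySeq fun n => u n v := fun v => by
    rw [Metric.cauchySeq_iff] at hu ⊢
    intro ε hε
    obtain ⟨N, hN⟩ := hu (ε / (‖v‖ + 1)) (by positivity)
    refine ⟨N, fun m hm n hn => ?_⟩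
    have h1 := hN m hm n hn
    rw [dist_eq_norm] at h1 ⊢
    have h2 : ‖u m v - u n v‖ ≤ ‖u m - u n‖ * ‖v‖ := norm_bound (u m - u n) v
    rw [lt_div_iff₀ (by positivity)] at h1
    nlinarith [norm_nonneg v, norm_nonneg (u m - u n)]
  choose φ hφ using fun v => cauchySeq_tendsto_of_complete (hC v)
  let ψ : V →ₗ[ℂ] X :=
    { toFun := φ
      map_add' := fun v w => tendsto_nhds_unique (hφ (v + w)) (by
        simpa only [map_add] using (hφ v).add (hφ w))
      map_smul' := fun c v => tendsto_nhds_unique (hφ (c • v)) (by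
        simpa only [map_smul] using! (hφ v).const_smul c) }
  have key : ∀ ε > 0, ∃ N, ∀ n ≥ N, ∀ (k : ℕ) (v : Matrix (Fin k) (Fin k) V),
      mnorm (v.map (u n) - v.map ψ) ≤ ε * mnorm v := fun ε hε => by
    rw [Metric.cauchySeq_iff] at hu
    obtain ⟨N, hN⟩ := hu ε hε
    refine ⟨N, fun n hn k v => ?_⟩
    have ht : Tendsto (fun m => mnorm (v.map (u n) - v.map (u m))) atTop
        (𝓝 (mnorm (v.map (u n) - v.map ψ))) := by
      refine (uniformContinuous_mnorm.continuous.tendsto _).comp ?_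
      refine tendsto_pi_nhds.2 fun i => tendsto_pi_nhds.2 fun j => ?_
      exact tendsto_const_nhds.sub (hφ (v i j))
    refine le_of_tendsto ht (eventually_atTop.2 ⟨N, fun m hm => ?_⟩)
    have h1 := map_bound (u n - u m) v
    have h2 := (hN n hn m hm).le
    rw [dist_eq_norm] at h2
    exact h1.trans (mul_le_mul_of_nonneg_right h2 (mnorm_nonneg _))
  have hψ : IsCB ψ := by
    obtain ⟨N, hN⟩ := key 1 one_pos
    refine ⟨‖u N‖ + 1, fun k v => ?_⟩
    have h1 := mnorm_sub_le (v.map (u N)) (v.map ψ)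
    have h2 := hN N le_rfl k v
    have h3 := map_bound (u N) v
    have h4 := (abs_le.1 h1).1
    linarith
  refine ⟨mk ψ hψ, ?_⟩
  rw [Metric.tendsto_atTop]
  intro ε hε
  obtain ⟨N, hN⟩ := key (ε / 2) (by positivity)
  refine ⟨N, fun n hn => ?_⟩
  rw [dist_eq_norm]
  have : ‖u n - mk ψ hψ‖ ≤ ε / 2 :=
    norm_le (φ := u n - mk ψ hψ) (by positivity) fun k v => hN n hn k v
  exact lt_of_le_of_lt this (by linarith)

end CB

namespace JCB

theorem map_bound (φ : JCB V W X) {ι τ : Type} [Fintype ι] [Fintype τ]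
    (v : Matrix ι ι V) (w : Matrix τ τ W) :
    mnorm (Matrix.kroneckerMap (fun v w => φ v w) v w) ≤ ‖φ‖ * (mnorm v * mnorm w) := by
  refine le_trans (le_of_eq ?_) (matrixNorm_bound (unit φ) v w)
  rw [← mnorm_submatrix_equiv _ (Equiv.punitProd (ι × τ)).symm]
  rfl

theorem norm_le {φ : JCB V W X} {C : ℝ} (hC : 0 ≤ C)
    (h : ∀ (n : ℕ) (v : Matrix (Fin n) (Fin n) V) (w : Matrix (Fin n) (Fin n) W),
      mnorm (Matrix.kroneckerMap (fun v w => φ v w) v w) ≤ C * (mnorm v * mnorm w)) : ‖φ‖ ≤ C := by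
  refine csInf_le ⟨0, fun _ h => h.1⟩ ⟨hC, fun n v w => ?_⟩
  refine le_trans (le_of_eq ?_) (h n v w)
  rw [← mnorm_submatrix_equiv _ (Equiv.punitProd (Fin n × Fin n)).symm]
  rfl

instance [CompleteSpace X] : CompleteSpace (JCB V W X) := by
  refine Metric.complete_of_cauchySeq_tendsto fun u hu => ?_
  have hC : ∀ v w, CauchySeq fun n => u n v w := fun v w => by
    rw [Metric.cauchySeq_iff] at hu ⊢
    intro ε hε
    obtain ⟨N, hN⟩ := hu (ε / (‖v‖ * ‖w‖ + 1)) (by positivity)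
    refine ⟨N, fun m hm n hn => ?_⟩
    have h1 := hN m hm n hn
    rw [dist_eq_norm] at h1 ⊢
    have h2 : ‖u m v w - u n v w‖ ≤ ‖u m - u n‖ * (‖v‖ * ‖w‖) := norm_bound (u m - u n) v w
    rw [lt_div_iff₀ (by positivity)] at h1
    nlinarith [norm_nonneg (u m - u n)]
  choose φ hφ using fun v w => cauchySeq_tendsto_of_complete (hC v w)
  let ψ : V →ₗ[ℂ] W →ₗ[ℂ] X := LinearMap.mk₂ ℂ φ
    (fun v v' w => tendsto_nhds_unique (hφ (v + v') w) (by
        simpa only [map_add, LinearMap.add_apply] using (hφ v w).add (hφ v' w)))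
    (fun c v w => tendsto_nhds_unique (hφ (c • v) w) (by
        simpa only [map_smul, LinearMap.smul_apply] using (hφ v w).const_smul c))
    (fun v w w' => tendsto_nhds_unique (hφ v (w + w')) (by
        simpa only [map_add] using (hφ v w).add (hφ v w')))
    (fun c v w => tendsto_nhds_unique (hφ v (c • w)) (by
        simpa only [map_smul] using (hφ v w).const_smul c))
  have key : ∀ ε > 0, ∃ N, ∀ n ≥ N, ∀ (k : ℕ) (v : Matrix (Fin k) (Fin k) V)
      (w : Matrix (Fin k) (Fin k) W),
      mnorm (Matrix.kroneckerMap (fun v w => u n v w) v w -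
        Matrix.kroneckerMap (fun v w => ψ v w) v w) ≤ ε * (mnorm v * mnorm w) := fun ε hε => by
    rw [Metric.cauchySeq_iff] at hu
    obtain ⟨N, hN⟩ := hu ε hε
    refine ⟨N, fun n hn k v w => ?_⟩
    have ht : Tendsto (fun m => mnorm (Matrix.kroneckerMap (fun v w => u n v w) v w -
        Matrix.kroneckerMap (fun v w => u m v w) v w)) atTop
        (𝓝 (mnorm (Matrix.kroneckerMap (fun v w => u n v w) v w -
          Matrix.kroneckerMap (fun v w => ψ v w) v w))) := by
      refine (uniformContinuous_mnorm.continuous.tendsto _).comp ?_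
      refine tendsto_pi_nhds.2 fun i => tendsto_pi_nhds.2 fun j => ?_
      exact tendsto_const_nhds.sub (hφ (v i.1 j.1) (w i.2 j.2))
    refine le_of_tendsto ht (eventually_atTop.2 ⟨N, fun m hm => ?_⟩)
    have h1 := map_bound (u n - u m) v w
    have h2 := (hN n hn m hm).le
    rw [dist_eq_norm] at h2
    exact h1.trans (mul_le_mul_of_nonneg_right h2
      (mul_nonneg (mnorm_nonneg _) (mnorm_nonneg _)))
  have hψ : IsJCB ψ := by
    obtain ⟨N, hN⟩ := key 1 one_pos
    refine ⟨‖u N‖ + 1, fun k v w => ?_⟩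
    have h1 := mnorm_sub_le (Matrix.kroneckerMap (fun v w => u N v w) v w)
      (Matrix.kroneckerMap (fun v w => ψ v w) v w)
    have h2 := hN N le_rfl k v w
    have h3 := map_bound (u N) v w
    have h4 := (abs_le.1 h1).1
    linarith
  refine ⟨mk ψ hψ, ?_⟩
  rw [Metric.tendsto_atTop]
  intro ε hε
  obtain ⟨N, hN⟩ := key (ε / 2) (by positivity)
  refine ⟨N, fun n hn => ?_⟩
  rw [dist_eq_norm]
  have : ‖u n - mk ψ hψ‖ ≤ ε / 2 :=
    norm_le (φ := u n - mk ψ hψ) (by positivity)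
      fun k v w => hN n hn k v w
  exact lt_of_le_of_lt this (by linarith)

end JCB

end Complete

section Compl

open UniformSpace UniformSpace.Completion

variable {A : Type*} [SeminormedAddCommGroup A] [NormedSpace ℂ A]
  {ι κ : Type} [Fintype ι] [Fintype κ]

/-- The entrywise inclusion of `M_ι(A)` in the matrices over the completion. -/
def toComplMatrix (x : Matrix ι ι A) : Matrix ι ι (Completion A) := x.map (fun a => (a : Completion A))

theorem isUniformInducing_toComplMatrix :
    IsUniformInducing (toComplMatrix : Matrix ι ι A → Matrix ι ι (Completion A)) := by
  refine ⟨?_⟩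
  rw [Matrix.uniformity, Matrix.uniformity]
  simp only [Filter.comap_iInf, Filter.comap_comap]
  refine iInf_congr fun i => iInf_congr fun j => ?_
  rw [← (Completion.isUniformInducing_coe A).comap_uniformity, Filter.comap_comap]
  rfl

theorem denseRange_toComplMatrix :
    DenseRange (toComplMatrix : Matrix ι ι A → Matrix ι ι (Completion A)) :=
  DenseRange.piMap fun _ => DenseRange.piMap fun _ => denseRange_coe

variable [OperatorSpace A]

/-- The norm of a matrix over the completion: the continuous extension of the norm of `M_ι(A)`. -/
def complNorm : Matrix ι ι (Completion A) → ℝ :=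
  (isUniformInducing_toComplMatrix.isDenseInducing denseRange_toComplMatrix).extend mnorm

theorem uniformContinuous_complNorm :
    UniformContinuous (complNorm : Matrix ι ι (Completion A) → ℝ) :=
  uniformContinuous_uniformly_extend isUniformInducing_toComplMatrix denseRange_toComplMatrix
    uniformContinuous_mnorm

theorem continuous_complNorm : Continuous (complNorm : Matrix ι ι (Completion A) → ℝ) :=
  uniformContinuous_complNorm.continuous

theorem complNorm_coe (x : Matrix ι ι A) : complNorm (toComplMatrix x) = mnorm x :=
  uniformly_extend_of_ind isUniformInducing_toComplMatrix denseRange_toComplMatrix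
    uniformContinuous_mnorm x

theorem continuous_sandwich {V : Type*} [SeminormedAddCommGroup V] [NormedSpace ℂ V]
    (α : Matrix κ ι ℂ) (β : Matrix ι κ ℂ) : Continuous fun v : Matrix ι ι V => sandwich α v β := by
  refine continuous_matrix fun i j => ?_
  simp only [sandwich, Matrix.of_apply]
  fun_prop

variable (A) in
/-- The matrix norm of the completion. -/
def complSeminorm : MatrixSeminorm (Completion A) where
  toFun := complNorm
  add_le v w := by
    refine denseRange_toComplMatrix.induction_on₂ (isClosed_le
      (continuous_complNorm.comp continuous_add)
      ((continuous_complNorm.comp continuous_fst).add (continuous_complNorm.comp continuous_snd)))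
      (fun a b => ?_) v w
    have e : toComplMatrix a + toComplMatrix b = toComplMatrix (a + b) := by
      ext i j; simp [toComplMatrix, coe_add]
    rw [e, complNorm_coe, complNorm_coe, complNorm_coe]
    exact mnorm_add_le a b
  smul c v := by
    refine denseRange_toComplMatrix.induction_on v (isClosed_eq
      (continuous_complNorm.comp (continuous_const_smul c))
      (continuous_const.mul continuous_complNorm)) (fun a => ?_)
    have e : c • toComplMatrix a = toComplMatrix (c • a) := by
      ext i j; simp [toComplMatrix, coe_smul]
    rw [e, complNorm_coe, complNorm_coe]
    exact mnorm_smul c a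
  M1 {ι κ} _ _ v w := by
    have hc : ∀ (v : Matrix ι ι (Completion A)) (w : Matrix κ κ (Completion A)),
        complNorm (Matrix.fromBlocks v 0 0 w) = max (complNorm v) (complNorm w) := by
      have key : IsClosed {p : Matrix ι ι (Completion A) × Matrix κ κ (Completion A) |
          complNorm (Matrix.fromBlocks p.1 0 0 p.2) = max (complNorm p.1) (complNorm p.2)} := by
        refine isClosed_eq (continuous_complNorm.comp ?_)
          ((continuous_complNorm.comp continuous_fst).max
            (continuous_complNorm.comp continuous_snd))
        exact continuous_fst.matrix_fromBlocks continuous_const continuous_const continuous_snd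
      intro v w
      have hd := (denseRange_toComplMatrix (ι := ι) (A := A)).prodMap
        (denseRange_toComplMatrix (ι := κ) (A := A))
      refine hd.induction_on (p := fun p => complNorm (Matrix.fromBlocks p.1 0 0 p.2) =
        max (complNorm p.1) (complNorm p.2)) (v, w) key (fun a => ?_)
      have e : Matrix.fromBlocks (toComplMatrix a.1) 0 0 (toComplMatrix a.2) =
          toComplMatrix (Matrix.fromBlocks a.1 0 0 a.2) := by
        ext i j; cases i <;> cases j <;> simp [toComplMatrix, coe_zero]
      simp only [Prod.map_fst, Prod.map_snd]
      rw [e, complNorm_coe, complNorm_coe, complNorm_coe]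
      exact mnorm_fromBlocks _ _
    exact hc v w
  M2 α v β := by
    refine denseRange_toComplMatrix.induction_on v (isClosed_le
      (continuous_complNorm.comp (continuous_sandwich α β))
      ((continuous_const.mul continuous_complNorm).mul continuous_const)) (fun a => ?_)
    have e : sandwich α (toComplMatrix a) β = toComplMatrix (sandwich α a β) := by
      ext i j
      simp only [sandwich, toComplMatrix, Matrix.of_apply, Matrix.map_apply]
      rw [← coe_toComplL (𝕜 := ℂ)]
      simp only [map_sum, map_smul]
    rw [e, complNorm_coe, complNorm_coe]
    exact (OperatorSpace.toMatrixSeminorm (V := A)).M2 α a β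

/-- The completion of an operator space. -/
instance : OperatorSpace (Completion A) where
  toMatrixSeminorm := complSeminorm A
  norm_unit v := by
    refine denseRange_coe.induction_on v (isClosed_eq
      (continuous_complNorm.comp (continuous_matrix fun _ _ => continuous_id)) continuous_norm)
      (fun a => ?_)
    rw [norm_coe, ← mnorm_unit]
    exact complNorm_coe (unit a)

theorem mnorm_coe (x : Matrix ι ι A) : mnorm (toComplMatrix x) = mnorm x := complNorm_coe x

end Compl

section Sandwich

variable {U : Type*} [AddCommGroup U] [Module ℂ U] {ι κ τ : Type} [Fintype ι] [Fintype κ]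
  [Fintype τ]

theorem sandwich_sandwich (A : Matrix τ κ ℂ) (α : Matrix κ ι ℂ) (v : Matrix ι ι U)
    (β : Matrix ι κ ℂ) (B : Matrix κ τ ℂ) :
    sandwich A (sandwich α v β) B = sandwich (A * α) v (β * B) := by
  ext i j
  simp only [sandwich, Matrix.of_apply, Matrix.mul_apply, Finset.smul_sum, smul_smul,
    Finset.sum_mul_sum, Finset.sum_smul]
  have h1 : ∀ (k l : κ), ∑ x : ι, ∑ y : ι, (A i k * B l j * (α k x * β y l)) • v x y =
      ∑ x : ι, ∑ y : ι, (A i k * α k x * (β y l * B l j)) • v x y := fun k l =>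
    Finset.sum_congr rfl fun x _ => Finset.sum_congr rfl fun y _ => by
      congr 1; ring
  simp only [h1]
  calc _ = ∑ k, ∑ x, ∑ l, ∑ y, (A i k * α k x * (β y l * B l j)) • v x y :=
        Finset.sum_congr rfl fun k _ => Finset.sum_comm
    _ = ∑ x, ∑ k, ∑ l, ∑ y, (A i k * α k x * (β y l * B l j)) • v x y := Finset.sum_comm
    _ = ∑ x, ∑ k, ∑ y, ∑ l, (A i k * α k x * (β y l * B l j)) • v x y :=
        Finset.sum_congr rfl fun x _ => Finset.sum_congr rfl fun k _ => Finset.sum_comm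
    _ = _ := Finset.sum_congr rfl fun x _ => Finset.sum_comm

theorem submatrix_eq_sandwich [DecidableEq ι] (v : Matrix ι ι U) (f : κ → ι) :
    v.submatrix f f = sandwich ((1 : Matrix ι ι ℂ).submatrix f id) v
      ((1 : Matrix ι ι ℂ).submatrix id f) := by
  ext i j
  simp [sandwich, Matrix.one_apply]

theorem sandwich_fromBlocks {σ : Type} [Fintype σ] (α : Matrix κ ι ℂ) (α' : Matrix σ τ ℂ)
    (v : Matrix ι ι U) (v' : Matrix τ τ U) (β : Matrix ι κ ℂ) (β' : Matrix τ σ ℂ) :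
    sandwich (Matrix.fromBlocks α 0 0 α') (Matrix.fromBlocks v 0 0 v') (Matrix.fromBlocks β 0 0 β')
      = Matrix.fromBlocks (sandwich α v β) 0 0 (sandwich α' v' β') := by
  ext i j
  cases i <;> cases j <;> simp [sandwich]

theorem sandwich_smul (α : Matrix κ ι ℂ) (c : ℂ) (v : Matrix ι ι U) (β : Matrix ι κ ℂ) :
    sandwich α (c • v) β = c • sandwich α v β := by
  ext i j
  simp only [sandwich, Matrix.of_apply, Matrix.smul_apply, Finset.smul_sum]
  exact Finset.sum_congr rfl fun k _ => Finset.sum_congr rfl fun l _ => smul_comm _ _ _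

/-- The row `[s 1, t 1]`. -/
def rowPair (κ : Type) [DecidableEq κ] (s t : ℝ) : Matrix κ (κ ⊕ κ) ℂ :=
  Matrix.of fun i j => Sum.elim (fun k => if i = k then (s : ℂ) else 0)
      (fun k => if i = k then (t : ℂ) else 0) j

theorem sandwich_rowPair [DecidableEq κ] (s t : ℝ) (u u' : Matrix κ κ U) :
    sandwich (rowPair κ s t) (Matrix.fromBlocks u 0 0 u') (rowPair κ s t).conjTranspose
      = (s * s : ℂ) • u + (t * t : ℂ) • u' := by
  ext i j
  simp [sandwich, rowPair, apply_ite]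

end Sandwich

section Proj

variable (V W : Type*) [NormedAddCommGroup V] [NormedSpace ℂ V] [OperatorSpace V]
  [NormedAddCommGroup W] [NormedSpace ℂ W] [OperatorSpace W]

/-- The algebraic tensor product `V ⊗ W`, to be endowed with the operator space projective
tensor norm. -/
def AlgTensor : Type _ := V ⊗[ℂ] W

instance : AddCommGroup (AlgTensor V W) := inferInstanceAs (AddCommGroup (V ⊗[ℂ] W))
instance : Module ℂ (AlgTensor V W) := inferInstanceAs (Module ℂ (V ⊗[ℂ] W))

variable {V W}

/-- The elementary tensor `v ⊗ w`. -/
def tmul (v : V) (w : W) : AlgTensor V W := v ⊗ₜ[ℂ] w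

theorem AlgTensor.induction {P : AlgTensor V W → Prop} (h0 : ∀ v w, P (tmul v w))
    (hadd : ∀ x y, P x → P y → P (x + y)) (x : AlgTensor V W) : P x :=
  TensorProduct.induction_on (motive := P) x
    ((TensorProduct.zero_tmul V (0 : W) : (0 : V) ⊗ₜ[ℂ] (0 : W) = 0) ▸ h0 0 0) h0 hadd

/-- The matrix `v ⊗ w = (v i j ⊗ w k l)`, with rows `(i, k)` and columns `(j, l)`. -/
def matTmul {ι τ : Type} (v : Matrix ι ι V) (w : Matrix τ τ W) :
    Matrix (ι × τ) (ι × τ) (AlgTensor V W) := Matrix.kroneckerMap tmul v w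

open Classical in
/-- The operator space projective tensor norm: the infimum of `‖α‖ ‖v‖ ‖w‖ ‖β‖` over all
representations `u = α (v ⊗ w) β` with `v ∈ M_p(V)`, `w ∈ M_q(W)`. -/
def projNorm {κ : Type} [Fintype κ] (u : Matrix κ κ (AlgTensor V W)) : ℝ :=
  sInf {r : ℝ | ∃ (p q : ℕ) (α : Matrix κ (Fin p × Fin q) ℂ) (v : Matrix (Fin p) (Fin p) V)
    (w : Matrix (Fin q) (Fin q) W) (β : Matrix (Fin p × Fin q) κ ℂ),
    u = sandwich α (matTmul v w) β ∧ r = ‖α‖ * mnorm v * mnorm w * ‖β‖}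

/-- `u = α (v ⊗ w) β` with the given bounds on the factors. -/
def Rep {κ : Type} [Fintype κ] [DecidableEq κ] (u : Matrix κ κ (AlgTensor V W))
    (a c d b : ℝ) : Prop :=
  ∃ (ι τ : Type) (_ : Fintype ι) (_ : DecidableEq ι) (_ : Fintype τ) (_ : DecidableEq τ)
    (α : Matrix κ (ι × τ) ℂ) (v : Matrix ι ι V) (w : Matrix τ τ W) (β : Matrix (ι × τ) κ ℂ),
    u = sandwich α (matTmul v w) β ∧ ‖α‖ ≤ a ∧ mnorm v ≤ c ∧ mnorm w ≤ d ∧ ‖β‖ ≤ b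

variable {κ σ : Type} [Fintype κ] [DecidableEq κ] [Fintype σ] [DecidableEq σ]

theorem Rep.sandwich {u : Matrix κ κ (AlgTensor V W)} {a c d b : ℝ} (h : Rep u a c d b)
    (A : Matrix σ κ ℂ) (B : Matrix κ σ ℂ) :
    Rep (sandwich A u B) (‖A‖ * a) c d (b * ‖B‖) := by
  obtain ⟨ι, τ, i1, i2, i3, i4, α, v, w, β, rfl, h1, h2, h3, h4⟩ := h
  refine ⟨ι, τ, i1, i2, i3, i4, A * α, v, w, β * B, sandwich_sandwich _ _ _ _ _, ?_, h2, h3, ?_⟩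
  · exact (Matrix.l2_opNorm_mul _ _).trans (by gcongr)
  · exact (Matrix.l2_opNorm_mul _ _).trans (by gcongr)

theorem Rep.block {u : Matrix κ κ (AlgTensor V W)} {u' : Matrix σ σ (AlgTensor V W)}
    {a c d b a' c' d' b' : ℝ} (h : Rep u a c d b) (h' : Rep u' a' c' d' b') :
    Rep (Matrix.fromBlocks u 0 0 u') (max a a') (max c c') (max d d') (max b b') := by
  obtain ⟨ι, τ, i1, i2, i3, i4, α, v, w, β, rfl, h1, h2, h3, h4⟩ := h
  obtain ⟨ι', τ', _, _, _, _, α', v', w', β', rfl, h1', h2', h3', h4'⟩ := h'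
  let f : (ι × τ) ⊕ (ι' × τ') → (ι ⊕ ι') × (τ ⊕ τ') :=
    Sum.elim (Prod.map Sum.inl Sum.inl) (Prod.map Sum.inr Sum.inr)
  have hf : Function.Injective f := by
    rintro (⟨x, y⟩ | ⟨x, y⟩) (⟨x', y'⟩ | ⟨x', y'⟩) h <;> simp [f] at h ⊢ <;> exact h
  refine ⟨ι ⊕ ι', τ ⊕ τ', inferInstance, inferInstance, inferInstance, inferInstance,
    Matrix.fromBlocks α 0 0 α' * (1 : Matrix _ _ ℂ).submatrix f id,
    Matrix.fromBlocks v 0 0 v', Matrix.fromBlocks w 0 0 w',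
    (1 : Matrix _ _ ℂ).submatrix id f * Matrix.fromBlocks β 0 0 β', ?_, ?_, ?_, ?_, ?_⟩
  · rw [← sandwich_sandwich, ← submatrix_eq_sandwich, ← sandwich_fromBlocks]
    congr 1
    ext i j
    rcases i with ⟨x, y⟩ | ⟨x, y⟩ <;> rcases j with ⟨x', y'⟩ | ⟨x', y'⟩ <;>
      simp [f, matTmul, tmul] <;> rfl
  · refine (Matrix.l2_opNorm_mul _ _).trans ?_
    calc _ ≤ max ‖α‖ ‖α'‖ * 1 := by
          gcongr
          · exact l2_fromBlocks_le _ _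
          · exact l2_inj_row f hf
      _ ≤ _ := by rw [mul_one]; exact max_le_max h1 h1'
  · rw [mnorm_fromBlocks]; exact max_le_max h2 h2'
  · rw [mnorm_fromBlocks]; exact max_le_max h3 h3'
  · refine (Matrix.l2_opNorm_mul _ _).trans ?_
    calc _ ≤ 1 * max ‖β‖ ‖β'‖ := by
          gcongr
          · exact l2_inj_col f hf
          · exact l2_fromBlocks_le _ _
      _ ≤ _ := by rw [one_mul]; exact max_le_max h4 h4'

theorem matTmul_smul_left {ι τ : Type} (s : ℂ) (v : Matrix ι ι V) (w : Matrix τ τ W) :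
    matTmul (s • v) w = s • matTmul v w := by
  ext i j
  exact TensorProduct.smul_tmul' s _ _

theorem matTmul_smul_right {ι τ : Type} (s : ℂ) (v : Matrix ι ι V) (w : Matrix τ τ W) :
    matTmul v (s • w) = s • matTmul v w := by
  ext i j
  exact TensorProduct.tmul_smul s _ _

theorem Rep.smul {u : Matrix κ κ (AlgTensor V W)} {a c d b : ℝ} (h : Rep u a c d b) (s : ℂ) :
    Rep (s • u) a (‖s‖ * c) d b := by
  obtain ⟨ι, τ, i1, i2, i3, i4, α, v, w, β, rfl, h1, h2, h3, h4⟩ := h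
  refine ⟨ι, τ, i1, i2, i3, i4, α, s • v, w, β, ?_, h1, ?_, h3, h4⟩
  · rw [matTmul_smul_left, sandwich_smul]
  · rw [mnorm_smul]; gcongr

theorem Rep.scale {u : Matrix κ κ (AlgTensor V W)} {a c d b : ℝ} (ha : 0 < a)
    (hd : 0 < d) (hb : 0 < b) (h : Rep u a c d b) : Rep u 1 (a * c * d * b) 1 1 := by
  obtain ⟨ι, τ, i1, i2, i3, i4, α, v, w, β, rfl, h1, h2, h3, h4⟩ := h
  have hn : ∀ x : ℝ, 0 < x → ‖((x : ℂ))‖ = x := fun x hx => by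
    rw [Complex.norm_real, Real.norm_of_nonneg hx.le]
  refine ⟨ι, τ, i1, i2, i3, i4, ((a⁻¹ : ℝ) : ℂ) • α, ((a * d * b : ℝ) : ℂ) • v,
    ((d⁻¹ : ℝ) : ℂ) • w, ((b⁻¹ : ℝ) : ℂ) • β, ?_, ?_, ?_, ?_, ?_⟩
  · rw [matTmul_smul_left, matTmul_smul_right, sandwich_smul, sandwich_smul]
    ext i j
    simp only [OpSp.sandwich, Matrix.of_apply, Matrix.smul_apply, Finset.smul_sum, smul_smul,
      smul_eq_mul]
    refine Finset.sum_congr rfl fun k _ => Finset.sum_congr rfl fun l _ => ?_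
    congr 1
    have : (a : ℂ) ≠ 0 := by exact_mod_cast ha.ne'
    have : (b : ℂ) ≠ 0 := by exact_mod_cast hb.ne'
    have : (d : ℂ) ≠ 0 := by exact_mod_cast hd.ne'
    push_cast
    field_simp
  · rw [norm_smul, hn _ (by positivity), inv_mul_le_iff₀ ha, mul_one]; exact h1
  · rw [mnorm_smul, hn _ (by positivity)]
    calc _ ≤ a * d * b * c := by gcongr
      _ = _ := by ring
  · rw [mnorm_smul, hn _ (by positivity), inv_mul_le_iff₀ hd, mul_one]; exact h3
  · rw [norm_smul, hn _ (by positivity), inv_mul_le_iff₀ hb, mul_one]; exact h4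

theorem projNorm_bddBelow {κ : Type} [Fintype κ] [DecidableEq κ]
    (u : Matrix κ κ (AlgTensor V W)) : BddBelow {r : ℝ |
    ∃ (p q : ℕ) (α : Matrix κ (Fin p × Fin q) ℂ) (v : Matrix (Fin p) (Fin p) V)
    (w : Matrix (Fin q) (Fin q) W) (β : Matrix (Fin p × Fin q) κ ℂ),
    u = OpSp.sandwich α (matTmul v w) β ∧ r = ‖α‖ * mnorm v * mnorm w * ‖β‖} := by
  refine ⟨0, ?_⟩
  rintro r ⟨p, q, α, v, w, β, -, rfl⟩
  have := mnorm_nonneg v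
  have := mnorm_nonneg w
  positivity

theorem projNorm_eq {κ : Type} [Fintype κ] [DecidableEq κ] (u : Matrix κ κ (AlgTensor V W)) :
    projNorm u = sInf {r : ℝ |
    ∃ (p q : ℕ) (α : Matrix κ (Fin p × Fin q) ℂ) (v : Matrix (Fin p) (Fin p) V)
    (w : Matrix (Fin q) (Fin q) W) (β : Matrix (Fin p × Fin q) κ ℂ),
    u = OpSp.sandwich α (matTmul v w) β ∧ r = ‖α‖ * mnorm v * mnorm w * ‖β‖} := by
  unfold projNorm
  congr!

theorem Rep.fin {u : Matrix κ κ (AlgTensor V W)} {a c d b : ℝ} (h : Rep u a c d b) :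
    ∃ (p q : ℕ) (α : Matrix κ (Fin p × Fin q) ℂ) (v : Matrix (Fin p) (Fin p) V)
    (w : Matrix (Fin q) (Fin q) W) (β : Matrix (Fin p × Fin q) κ ℂ),
    u = OpSp.sandwich α (matTmul v w) β ∧ ‖α‖ ≤ a ∧ mnorm v ≤ c ∧ mnorm w ≤ d ∧ ‖β‖ ≤ b := by
  obtain ⟨ι, τ, i1, i2, i3, i4, α, v, w, β, rfl, h1, h2, h3, h4⟩ := h
  have e := (Fintype.equivFin ι).symm
  have e' := (Fintype.equivFin τ).symm
  let f := (e.prodCongr e').symm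
  refine ⟨_, _, α * (1 : Matrix _ _ ℂ).submatrix f id, v.submatrix e e, w.submatrix e' e',
    (1 : Matrix _ _ ℂ).submatrix id f * β, ?_, ?_, ?_, ?_, ?_⟩
  · rw [← sandwich_sandwich, ← submatrix_eq_sandwich]
    congr 1
    ext i j
    simp [f, matTmul]
  · refine (Matrix.l2_opNorm_mul _ _).trans ?_
    calc _ ≤ ‖α‖ * 1 := by
          gcongr
          exact l2_inj_row f f.injective
      _ ≤ _ := by rw [mul_one]; exact h1
  · rw [mnorm_submatrix_equiv]; exact h2
  · rw [mnorm_submatrix_equiv]; exact h3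
  · refine (Matrix.l2_opNorm_mul _ _).trans ?_
    calc _ ≤ 1 * ‖β‖ := by
          gcongr
          exact l2_inj_col f f.injective
      _ ≤ _ := by rw [one_mul]; exact h4

theorem Rep.projNorm_le {u : Matrix κ κ (AlgTensor V W)} {a c d b : ℝ} (h : Rep u a c d b) :
    projNorm u ≤ a * c * d * b := by
  obtain ⟨p, q, α, v, w, β, hu, h1, h2, h3, h4⟩ := h.fin
  rw [projNorm_eq]
  have := mnorm_nonneg v
  have := mnorm_nonneg w
  have ha := (norm_nonneg α).trans h1
  have hb := (norm_nonneg β).trans h4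
  have hc := this.trans h3
  have hd := (mnorm_nonneg v).trans h2
  refine (csInf_le (projNorm_bddBelow u) ⟨p, q, α, v, w, β, hu, rfl⟩).trans ?_
  gcongr

theorem Rep.mono {u : Matrix κ κ (AlgTensor V W)} {a c d b a' c' d' b' : ℝ} (h : Rep u a c d b)
    (ha : a ≤ a') (hc : c ≤ c') (hd : d ≤ d') (hb : b ≤ b') : Rep u a' c' d' b' := by
  obtain ⟨ι, τ, i1, i2, i3, i4, α, v, w, β, hu, h1, h2, h3, h4⟩ := h
  exact ⟨ι, τ, i1, i2, i3, i4, α, v, w, β, hu, h1.trans ha, h2.trans hc, h3.trans hd, h4.trans hb⟩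

theorem exists_rep_add {u u' : Matrix κ κ (AlgTensor V W)} (h : ∃ a c d b, Rep u a c d b)
    (h' : ∃ a c d b, Rep u' a c d b) : ∃ a c d b, Rep (u + u') a c d b := by
  obtain ⟨a, c, d, b, h⟩ := h
  obtain ⟨a', c', d', b', h'⟩ := h'
  have := (h.block h').sandwich (rowPair κ 1 1) (rowPair κ 1 1).conjTranspose
  rw [sandwich_rowPair] at this
  simp only [Complex.ofReal_one, mul_one, one_smul] at this
  exact ⟨_, _, _, _, this⟩

theorem exists_rep_single (i j : κ) (x : AlgTensor V W) :
    ∃ a c d b, Rep (Matrix.single i j x) a c d b := by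
  have h0 : ∀ (v : V) (w : W), ∃ a c d b, Rep (Matrix.single i j (tmul v w)) a c d b := by
    intro v w
    refine ⟨_, _, _, _, Unit, Unit, inferInstance, inferInstance, inferInstance, inferInstance,
      Matrix.of fun k _ => if k = i then 1 else 0, unit v, unit w,
      Matrix.of fun _ k => if k = j then 1 else 0, ?_, le_rfl, le_rfl, le_rfl, le_rfl⟩
    ext k l
    by_cases h1 : k = i
    · by_cases h2 : l = j <;>
        simp [OpSp.sandwich, h1, h2, matTmul, unit, Ne.symm]
    · simp [OpSp.sandwich, h1, Ne.symm h1]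
  refine AlgTensor.induction (P := fun x => ∃ a c d b, Rep (Matrix.single i j x) a c d b) h0 ?_ x
  intro x y hx hy
  rw [Matrix.single_add]
  exact exists_rep_add hx hy

theorem exists_rep (u : Matrix κ κ (AlgTensor V W)) : ∃ a c d b, Rep u a c d b := by
  have h0 : ∃ a c d b, Rep (0 : Matrix κ κ (AlgTensor V W)) a c d b :=
    ⟨_, _, _, _, Unit, Unit, inferInstance, inferInstance, inferInstance, inferInstance,
      0, 0, 0, 0, by ext; simp [OpSp.sandwich], le_rfl, le_rfl, le_rfl, le_rfl⟩
  have hs : ∀ {T : Type} (s : Finset T) (f : T → Matrix κ κ (AlgTensor V W)),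
      (∀ t, ∃ a c d b, Rep (f t) a c d b) → ∃ a c d b, Rep (∑ t ∈ s, f t) a c d b := by
    classical
    intro T s f hf
    induction s using Finset.induction_on with
    | empty => simpa using h0
    | insert t s ht ih => rw [Finset.sum_insert ht]; exact exists_rep_add (hf t) ih
  rw [Matrix.matrix_eq_sum_single u]
  exact hs _ _ fun i => hs _ _ fun j => exists_rep_single i j _

theorem rep_of_projNorm_lt {u : Matrix κ κ (AlgTensor V W)} {c : ℝ} (h : projNorm u < c) :
    Rep u 1 c 1 1 := by
  rw [projNorm_eq] at h
  obtain ⟨r, ⟨p, q, α, v, w, β, hu, rfl⟩, hr⟩ := exists_lt_of_csInf_lt (by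
    obtain ⟨a, c, d, b, h⟩ := exists_rep u
    obtain ⟨p, q, α, v, w, β, hu, -⟩ := h.fin
    exact ⟨_, p, q, α, v, w, β, hu, rfl⟩) h
  have hc : Filter.Tendsto (fun δ : ℝ => (‖α‖ + δ) * (mnorm v + δ) * (mnorm w + δ) * (‖β‖ + δ))
      (nhdsWithin 0 (Set.Ioi 0)) (nhds (‖α‖ * mnorm v * mnorm w * ‖β‖)) := by
    have : Continuous fun δ : ℝ => (‖α‖ + δ) * (mnorm v + δ) * (mnorm w + δ) * (‖β‖ + δ) := by
      fun_prop
    have := this.tendsto 0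
    simp only [add_zero] at this
    exact this.mono_left nhdsWithin_le_nhds
  obtain ⟨δ, hδ, hδ0⟩ := ((hc.eventually_lt_const hr).and self_mem_nhdsWithin).exists
  have hδ0 : 0 < δ := hδ0
  have h1 : Rep u (‖α‖ + δ) (mnorm v + δ) (mnorm w + δ) (‖β‖ + δ) :=
    ⟨Fin p, Fin q, _, inferInstance, _, inferInstance, α, v, w, β, hu,
      by linarith, by linarith, by linarith, by linarith⟩
  have := mnorm_nonneg v
  have := mnorm_nonneg w
  exact (h1.scale (by positivity) (by positivity) (by positivity)).mono le_rfl hδ.le le_rfl le_rfl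

theorem projNorm_nonneg (u : Matrix κ κ (AlgTensor V W)) : 0 ≤ projNorm u := by
  rw [projNorm_eq]
  refine Real.sInf_nonneg ?_
  rintro r ⟨p, q, α, v, w, β, -, rfl⟩
  have := mnorm_nonneg v
  have := mnorm_nonneg w
  positivity

theorem projNorm_sandwich_le (A : Matrix σ κ ℂ) (u : Matrix κ κ (AlgTensor V W))
    (B : Matrix κ σ ℂ) : projNorm (OpSp.sandwich A u B) ≤ ‖A‖ * projNorm u * ‖B‖ := by
  have key : ∀ ε > 0, projNorm (OpSp.sandwich A u B) ≤ ‖A‖ * (projNorm u + ε) * ‖B‖ :=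
    fun ε hε => by
      have := ((rep_of_projNorm_lt (show projNorm u < projNorm u + ε by linarith)).sandwich
        A B).projNorm_le
      simpa using this
  have ht : Filter.Tendsto (fun ε : ℝ => ‖A‖ * (projNorm u + ε) * ‖B‖)
      (nhdsWithin 0 (Set.Ioi 0)) (nhds (‖A‖ * projNorm u * ‖B‖)) := by
    have : Continuous fun ε : ℝ => ‖A‖ * (projNorm u + ε) * ‖B‖ := by fun_prop
    have := this.tendsto 0
    simp only [add_zero] at this
    exact this.mono_left nhdsWithin_le_nhds
  exact ge_of_tendsto ht (Filter.eventually_of_mem self_mem_nhdsWithin fun ε hε => key ε hε)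

theorem projNorm_add_le (u u' : Matrix κ κ (AlgTensor V W)) :
    projNorm (u + u') ≤ projNorm u + projNorm u' := by
  refine le_of_forall_pos_le_add fun ε hε => ?_
  set s := projNorm u + ε / 2 with hs
  set t := projNorm u' + ε / 2 with ht
  have h1 := projNorm_nonneg u
  have h2 := projNorm_nonneg u'
  have hs0 : 0 < s := by positivity
  have ht0 : 0 < t := by positivity
  have hn : ∀ x : ℝ, 0 < x → ‖((x⁻¹ : ℝ) : ℂ)‖ * x = 1 := fun x hx => by
    rw [Complex.norm_real, Real.norm_of_nonneg (by positivity), inv_mul_cancel₀ hx.ne']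
  have r1 := (rep_of_projNorm_lt (show projNorm u < s by linarith)).smul ((s⁻¹ : ℝ) : ℂ)
  have r2 := (rep_of_projNorm_lt (show projNorm u' < t by linarith)).smul ((t⁻¹ : ℝ) : ℂ)
  rw [hn s hs0] at r1
  rw [hn t ht0] at r2
  have r3 := ((r1.block r2).sandwich (rowPair κ (√s) (√t))
    (rowPair κ (√s) (√t)).conjTranspose).projNorm_le
  have hsq : ∀ x : ℝ, 0 < x → ((√x : ℝ) : ℂ) * ((√x : ℝ) : ℂ) = (x : ℂ) := fun x hx => by
    rw [← Complex.ofReal_mul, Real.mul_self_sqrt hx.le]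
  have hi : ∀ x : ℝ, 0 < x → (x : ℂ) * ((x⁻¹ : ℝ) : ℂ) = 1 := fun x hx => by
    rw [← Complex.ofReal_mul, mul_inv_cancel₀ hx.ne', Complex.ofReal_one]
  rw [sandwich_rowPair, hsq s hs0, hsq t ht0, smul_smul, smul_smul, hi s hs0, hi t ht0, one_smul,
    one_smul, Matrix.l2_opNorm_conjTranspose] at r3
  have h3 : ‖rowPair κ (√s) (√t)‖ ≤ √(s + t) := by
    have := l2_row_pair_le (n := κ) (√s) (√t)
    rwa [Real.sq_sqrt hs0.le, Real.sq_sqrt ht0.le] at this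
  simp only [max_self, mul_one, one_mul] at r3
  calc _ ≤ _ := r3
    _ ≤ √(s + t) * √(s + t) := by gcongr
    _ = s + t := Real.mul_self_sqrt (by positivity)
    _ = _ := by rw [hs, ht]; ring

theorem projNorm_smul (c : ℂ) (u : Matrix κ κ (AlgTensor V W)) :
    projNorm (c • u) = ‖c‖ * projNorm u := by
  have key : ∀ (c : ℂ) (u : Matrix κ κ (AlgTensor V W)),
      projNorm (c • u) ≤ ‖c‖ * projNorm u := fun c u => by
    have h1 : ∀ ε > 0, projNorm (c • u) ≤ ‖c‖ * (projNorm u + ε) := fun ε hε => by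
      have := ((rep_of_projNorm_lt (show projNorm u < projNorm u + ε by linarith)).smul
        c).projNorm_le
      simpa using this
    have ht : Filter.Tendsto (fun ε : ℝ => ‖c‖ * (projNorm u + ε))
        (nhdsWithin 0 (Set.Ioi 0)) (nhds (‖c‖ * projNorm u)) := by
      have : Continuous fun ε : ℝ => ‖c‖ * (projNorm u + ε) := by fun_prop
      have := this.tendsto 0
      simp only [add_zero] at this
      exact this.mono_left nhdsWithin_le_nhds
    exact ge_of_tendsto ht (Filter.eventually_of_mem self_mem_nhdsWithin fun ε hε => h1 ε hε)
  refine le_antisymm (key c u) ?_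
  by_cases hc : c = 0
  · subst hc
    simpa using projNorm_nonneg ((0 : ℂ) • u)
  · have := key c⁻¹ (c • u)
    rw [smul_smul, inv_mul_cancel₀ hc, one_smul, norm_inv] at this
    have hc' : 0 < ‖c‖ := norm_pos_iff.2 hc
    calc _ ≤ ‖c‖ * (‖c‖⁻¹ * projNorm (c • u)) := by gcongr
      _ = _ := by field_simp

theorem projNorm_submatrix_le (u : Matrix κ κ (AlgTensor V W)) (f : σ → κ)
    (hf : Function.Injective f) : projNorm (u.submatrix f f) ≤ projNorm u := by
  rw [submatrix_eq_sandwich]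
  refine (projNorm_sandwich_le _ _ _).trans ?_
  have := projNorm_nonneg u
  calc _ ≤ 1 * projNorm u * 1 := by
        gcongr
        · exact l2_inj_row f hf
        · exact l2_inj_col f hf
    _ = _ := by ring

variable (V W) in
/-- The operator space projective tensor norm as a matrix seminorm on `V ⊗ W`. -/
def projSeminorm : MatrixSeminorm (AlgTensor V W) where
  toFun := projNorm
  add_le u u' := by classical exact projNorm_add_le u u'
  smul c u := by classical exact projNorm_smul c u
  M1 u u' := by
    classical
    refine le_antisymm (le_of_forall_pos_le_add fun ε hε => ?_) (max_le ?_ ?_)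
    · have r1 := rep_of_projNorm_lt (show projNorm u < projNorm u + ε by linarith)
      have r2 := rep_of_projNorm_lt (show projNorm u' < projNorm u' + ε by linarith)
      have := (r1.block r2).projNorm_le
      simpa [max_add_add_right] using this
    · exact projNorm_submatrix_le (Matrix.fromBlocks u 0 0 u') Sum.inl Sum.inl_injective
    · exact projNorm_submatrix_le (Matrix.fromBlocks u 0 0 u') Sum.inr Sum.inr_injective
  M2 α u β := projNorm_sandwich_le α u β

instance : SeminormedAddCommGroup (AlgTensor V W) := (projSeminorm V W).toSeminormed

instance : NormedSpace ℂ (AlgTensor V W) where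
  norm_smul_le c u := ((projSeminorm V W).smul c (unit u)).le

instance : OperatorSpace (AlgTensor V W) where
  toMatrixSeminorm := projSeminorm V W
  norm_unit _ := rfl

variable (V W) in
/-- The operator space projective tensor product: the completion of `V ⊗ W` for the operator
space projective tensor norm. -/
abbrev ProjTensor : Type _ := UniformSpace.Completion (AlgTensor V W)

end Proj

section Lift

open UniformSpace

variable {V W X Y : Type*} [NormedAddCommGroup V] [NormedSpace ℂ V] [OperatorSpace V]
  [NormedAddCommGroup W] [NormedSpace ℂ W] [OperatorSpace W]
  [NormedAddCommGroup X] [NormedSpace ℂ X] [OperatorSpace X]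
  [NormedAddCommGroup Y] [NormedSpace ℂ Y] [OperatorSpace Y]

/-- The linear map on `V ⊗ W` associated with a bilinear map. -/
def algLift (B : JCB V W Y) : AlgTensor V W →ₗ[ℂ] Y :=
  (TensorProduct.lift B.toBilin : V ⊗[ℂ] W →ₗ[ℂ] Y)

theorem algLift_tmul (B : JCB V W Y) (v : V) (w : W) : algLift B (tmul v w) = B v w :=
  TensorProduct.lift.tmul v w

theorem algLift_bound (B : JCB V W Y) {κ : Type} [Fintype κ] (u : Matrix κ κ (AlgTensor V W)) :
    mnorm (u.map (algLift B)) ≤ ‖B‖ * mnorm u := by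
  classical
  have key : ∀ ε > 0, mnorm (u.map (algLift B)) ≤ ‖B‖ * (mnorm u + ε) := fun ε hε => by
    obtain ⟨ι, τ, i1, i2, i3, i4, α, v, w, β, hu, h1, h2, h3, h4⟩ :=
      rep_of_projNorm_lt (show projNorm u < projNorm u + ε by linarith)
    have e : u.map (algLift B) =
        sandwich α (Matrix.kroneckerMap (fun v w => B v w) v w) β := by
      rw [hu]
      ext i j
      simp only [sandwich, Matrix.map_apply, Matrix.of_apply, map_sum, map_smul, matTmul,
        Matrix.kroneckerMap_apply, algLift_tmul]
    rw [e]
    have h5 := B.map_bound v w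
    have h6 := mnorm_nonneg (Matrix.kroneckerMap (fun v w => B v w) v w)
    have h7 := mnorm_nonneg v
    have h8 := mnorm_nonneg w
    have h9 : mnorm v * mnorm w ≤ (mnorm u + ε) * 1 :=
      mul_le_mul h2 h3 h8 (h7.trans h2)
    calc _ ≤ _ := mnorm_sandwich_le _ _ _
      _ ≤ 1 * (‖B‖ * (mnorm v * mnorm w)) * 1 := by gcongr
      _ = ‖B‖ * (mnorm v * mnorm w) := by ring
      _ ≤ ‖B‖ * ((mnorm u + ε) * 1) := by gcongr
      _ = _ := by ring
  have ht : Filter.Tendsto (fun ε : ℝ => ‖B‖ * (mnorm u + ε))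
      (nhdsWithin 0 (Set.Ioi 0)) (nhds (‖B‖ * mnorm u)) := by
    have : Continuous fun ε : ℝ => ‖B‖ * (mnorm u + ε) := by fun_prop
    have := this.tendsto 0
    simp only [add_zero] at this
    exact this.mono_left nhdsWithin_le_nhds
  exact ge_of_tendsto ht (Filter.eventually_of_mem self_mem_nhdsWithin fun ε hε => key ε hε)

theorem algLift_norm_le (B : JCB V W Y) (u : AlgTensor V W) : ‖algLift B u‖ ≤ ‖B‖ * ‖u‖ := by
  have := algLift_bound B (unit u)
  rw [mnorm_unit] at this
  refine le_trans (le_of_eq ?_) this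
  rw [← mnorm_unit]
  rfl

variable [CompleteSpace Y]

/-- The linear map `V ⊗^ W → Y` associated with a jointly completely bounded bilinear map
`B : V × W → Y`: the continuous extension of `v ⊗ w ↦ B v w`. -/
def projLift (B : JCB V W Y) : ProjTensor V W →L[ℂ] Y :=
  ((algLift B).mkContinuous ‖B‖ (algLift_norm_le B)).extend Completion.toComplL

theorem projLift_coe (B : JCB V W Y) (u : AlgTensor V W) :
    projLift B (u : Completion (AlgTensor V W)) = algLift B u :=
  ContinuousLinearMap.extend_eq _ Completion.denseRange_coe
    (Completion.isUniformInducing_coe _) u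

theorem projLift_tmul (B : JCB V W Y) (v : V) (w : W) :
    projLift B (tmul v w : Completion (AlgTensor V W)) = B v w := by
  rw [projLift_coe, algLift_tmul]

theorem projLift_bound (B : JCB V W Y) {κ : Type} [Fintype κ]
    (u : Matrix κ κ (ProjTensor V W)) : mnorm (u.map (projLift B)) ≤ ‖B‖ * mnorm u := by
  refine denseRange_toComplMatrix.induction_on u (isClosed_le
    (uniformContinuous_mnorm.continuous.comp ?_)
    (continuous_const.mul uniformContinuous_mnorm.continuous)) (fun a => ?_)
  · exact continuous_matrix fun i j => (projLift B).continuous.comp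
      (continuous_id.matrix_elem i j)
  · rw [mnorm_coe]
    refine le_trans (le_of_eq ?_) (algLift_bound B a)
    congr 1
    ext i j
    exact projLift_coe B (a i j)

end Lift

section Canonical

variable (V W X : Type*) [NormedAddCommGroup V] [NormedSpace ℂ V] [OperatorSpace V]
  [NormedAddCommGroup W] [NormedSpace ℂ W] [OperatorSpace W]
  [NormedAddCommGroup X] [NormedSpace ℂ X] [OperatorSpace X]

theorem mnorm_kron_le {X : Type*} [NormedAddCommGroup X] [NormedSpace ℂ X] [OperatorSpace X]
    {ι κ : Type} [Fintype ι] [Fintype κ] (a : Matrix κ κ ℂ) (x : Matrix ι ι X) :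
    mnorm (Matrix.kroneckerMap (fun (a : ℂ) (y : X) => a • y) a x) ≤ mnorm a * mnorm x := by
  classical
  rw [mnorm_complex]
  exact MatrixSeminorm.kron_le _ a x

variable {V W X}

/-- The operator `v ↦ f(v) x`. -/
def rankOne (f : Dual V) (x : X) : CB V X :=
  CB.mk
    { toFun := fun v => f v • x
      map_add' := fun v w => by rw [map_add, add_smul]
      map_smul' := fun c v => by rw [map_smul, smul_eq_mul, mul_smul]; rfl }
    ⟨‖f‖ * ‖x‖, fun n v => by
      have h1 := mnorm_kron_le (v.map f) (unit x)
      have h2 := f.map_bound v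
      rw [mnorm_unit] at h1
      have h3 := norm_nonneg x
      refine le_trans (le_of_eq ?_) (h1.trans (mul_le_mul_of_nonneg_right h2 h3) |>.trans
        (le_of_eq (by ring)))
      rw [← mnorm_submatrix_equiv _ (Equiv.prodPUnit.{0} (Fin n)).symm]
      rfl⟩

/-- The bilinear map `(v, w) ↦ φ(v, w) x`. -/
def bilinSmul (φ : JCB V W ℂ) (x : X) : JCB V W X :=
  JCB.mk (LinearMap.mk₂ ℂ (fun v w => φ v w • x)
      (fun v v' w => by simp [add_smul]) (fun c v w => by simp [mul_smul])
      (fun v w w' => by simp [add_smul]) (fun c v w => by simp [mul_smul]))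
    ⟨‖φ‖ * ‖x‖, fun n v w => by
      have h1 := mnorm_kron_le (Matrix.kroneckerMap (fun v w => φ v w) v w) (unit x)
      have h2 := φ.map_bound v w
      rw [mnorm_unit] at h1
      have h3 := norm_nonneg x
      refine le_trans (le_of_eq ?_) (h1.trans (mul_le_mul_of_nonneg_right h2 h3) |>.trans
        (le_of_eq (by ring)))
      rw [← mnorm_submatrix_equiv _ (Equiv.prodPUnit.{0} (Fin n × Fin n)).symm]
      rfl⟩

/-- The bilinear form `(v, w) ↦ f(v) g(w)`. -/
def bilinForm (f : Dual V) (g : Dual W) : JCB V W ℂ :=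
  JCB.mk (LinearMap.mk₂ ℂ (fun v w => f v * g w)
      (fun v v' w => by rw [map_add, add_mul])
      (fun c v w => by rw [map_smul, smul_eq_mul, smul_eq_mul, mul_assoc])
      (fun v w w' => by rw [map_add, mul_add])
      (fun c v w => by rw [map_smul, smul_eq_mul, smul_eq_mul]; ring))
    ⟨‖f‖ * ‖g‖, fun n v w => by
      have h1 := mnorm_kron_le (v.map f) (w.map g)
      have h2 := f.map_bound v
      have h3 := g.map_bound w
      refine h1.trans ((mul_le_mul h2 h3 (mnorm_nonneg _)
        (mul_nonneg (norm_nonneg _) (mnorm_nonneg _))).trans (le_of_eq (by ring)))⟩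

@[simp] theorem rankOne_apply (f : Dual V) (x : X) (v : V) : rankOne f x v = f v • x := rfl
@[simp] theorem bilinSmul_apply (φ : JCB V W ℂ) (x : X) (v : V) (w : W) :
    bilinSmul φ x v w = φ v w • x := rfl
@[simp] theorem bilinForm_apply (f : Dual V) (g : Dual W) (v : V) (w : W) :
    bilinForm f g v w = f v * g w := rfl

variable (V X) in
/-- The bilinear map `V* × X → CB(V, X)`, `(f, x) ↦ f(·) x`. -/
def rankOneJCB : JCB (Dual V) X (CB V X) :=
  JCB.mk (LinearMap.mk₂ ℂ rankOne
      (fun f f' x => by ext v; simp [add_smul])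
      (fun c f x => by ext v; simp [mul_smul])
      (fun f x x' => by ext v; simp)
      (fun c f x => by ext v; simp [smul_comm c]))
    ⟨1, fun n f x => by
      rw [one_mul]
      refine csInf_le ⟨0, fun _ h => h.1⟩ ⟨mul_nonneg (mnorm_nonneg _) (mnorm_nonneg _),
        fun m v => ?_⟩
      have h1 := mnorm_kron_le (Matrix.kroneckerMap (fun (φ : Dual V) (v : V) => φ v) f v) x
      have h2 : mnorm (Matrix.kroneckerMap (fun (φ : Dual V) (v : V) => φ v) f v)
        ≤ mnorm f * mnorm v := CB.matrixNorm_bound f v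
      refine le_trans (le_of_eq ?_) (h1.trans
        (mul_le_mul_of_nonneg_right h2 (mnorm_nonneg x)) |>.trans (le_of_eq (by ring)))
      rw [← mnorm_submatrix_equiv _ (show (Fin n × Fin n) × Fin m ≃ (Fin n × Fin m) × Fin n from
        ⟨fun p => ((p.1.1, p.2), p.1.2), fun p => ((p.1.1, p.2), p.1.2),
          fun _ => rfl, fun _ => rfl⟩)]
      rfl⟩

variable (V W) in
/-- The bilinear map `V* × W* → JCB(V × W, ℂ)`, `(f, g) ↦ f(·) g(·)`. -/
def bilinFormJCB : JCB (Dual V) (Dual W) (JCB V W ℂ) :=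
  JCB.mk (LinearMap.mk₂ ℂ bilinForm
      (fun f f' g => by ext v w; simp [add_mul])
      (fun c f g => by ext v w; simp [mul_assoc])
      (fun f g g' => by ext v w; simp [mul_add])
      (fun c f g => by ext v w; simp [mul_left_comm]))
    ⟨1, fun n f g => by
      rw [one_mul]
      refine csInf_le ⟨0, fun _ h => h.1⟩ ⟨mul_nonneg (mnorm_nonneg _) (mnorm_nonneg _),
        fun m v w => ?_⟩
      have h1 := mnorm_kron_le (Matrix.kroneckerMap (fun (φ : Dual V) (v : V) => φ v) f v)
        (Matrix.kroneckerMap (fun (φ : Dual W) (v : W) => φ v) g w)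
      have h2 : mnorm (Matrix.kroneckerMap (fun (φ : Dual V) (v : V) => φ v) f v)
        ≤ mnorm f * mnorm v := CB.matrixNorm_bound f v
      have h3 : mnorm (Matrix.kroneckerMap (fun (φ : Dual W) (v : W) => φ v) g w)
        ≤ mnorm g * mnorm w := CB.matrixNorm_bound g w
      refine le_trans (le_of_eq ?_) (h1.trans
        (mul_le_mul h2 h3 (mnorm_nonneg _) (mul_nonneg (mnorm_nonneg _) (mnorm_nonneg _))) |>.trans
          (le_of_eq (by ring)))
      rw [← mnorm_submatrix_equiv _ (Equiv.prodProdProdComm (Fin n) (Fin n) (Fin m) (Fin m))]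
      rfl⟩

variable (V W X) in
/-- The bilinear map `(V* ⊗^ W*) × X → JCB(V × W, X)`, `(f ⊗ g, x) ↦ f(·) g(·) x`. -/
def trilinJCB : JCB (ProjTensor (Dual V) (Dual W)) X (JCB V W X) :=
  JCB.mk (LinearMap.mk₂ ℂ (fun t x => bilinSmul (projLift (bilinFormJCB V W) t) x)
      (fun f f' g => by ext v w; simp [add_smul])
      (fun c f g => by ext v w; simp [mul_smul])
      (fun f g g' => by ext v w; simp)
      (fun c f g => by ext v w; simp [smul_comm c]))
    ⟨‖bilinFormJCB V W‖, fun n t x => by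
      refine csInf_le ⟨0, fun _ h => h.1⟩ ⟨mul_nonneg (norm_nonneg _)
        (mul_nonneg (mnorm_nonneg _) (mnorm_nonneg _)), fun m v w => ?_⟩
      have h1 := mnorm_kron_le (JCB.amp (t.map (projLift (bilinFormJCB V W))) v w) x
      have h2 : mnorm (JCB.amp (t.map (projLift (bilinFormJCB V W))) v w) ≤
        mnorm (t.map (projLift (bilinFormJCB V W))) * (mnorm v * mnorm w) :=
        JCB.matrixNorm_bound _ v w
      have h3 := projLift_bound (bilinFormJCB V W) t
      have h4 := h2.trans (mul_le_mul_of_nonneg_right h3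
        (mul_nonneg (mnorm_nonneg v) (mnorm_nonneg w)))
      refine le_trans (le_of_eq ?_) (h1.trans
        (mul_le_mul_of_nonneg_right h4 (mnorm_nonneg x)) |>.trans (le_of_eq (by ring)))
      rw [← mnorm_submatrix_equiv _ (show (Fin n × Fin n) × (Fin m × Fin m) ≃
          (Fin n × (Fin m × Fin m)) × Fin n from
        ⟨fun p => ((p.1.1, p.2), p.1.2), fun p => ((p.1.1, p.2), p.1.2),
          fun _ => rfl, fun _ => rfl⟩)]
      rfl⟩

variable (V X) in
/-- The canonical map `V* ⊗^ X → CB(V, X)`, determined by `f ⊗ x ↦ f(·) x`. -/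
def linPsi [CompleteSpace X] : ProjTensor (Dual V) X →L[ℂ] CB V X :=
  projLift (rankOneJCB V X)

variable (V W X) in
/-- The canonical map `Ψ : (V* ⊗^ W*) ⊗^ X → JCB(V × W, X)`, determined by
`(f ⊗ g) ⊗ x ↦ f(·) g(·) x`. -/
def psi [CompleteSpace X] :
    ProjTensor (ProjTensor (Dual V) (Dual W)) X →L[ℂ] JCB V W X :=
  projLift (trilinJCB V W X)

end Canonical

section Image

variable {T Y : Type*} [NormedAddCommGroup T] [NormedSpace ℂ T] [OperatorSpace T]
  [NormedAddCommGroup Y] [NormedSpace ℂ Y] (P : T →L[ℂ] Y)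

/-- The image of a continuous linear map `P : T → Y`, to be endowed with the operator space
structure of the quotient `T / ker P` (and not with that of a subspace of `Y`). -/
def Image : Type _ := LinearMap.range P.toLinearMap

namespace Image

instance : AddCommGroup (Image P) := inferInstanceAs (AddCommGroup (LinearMap.range P.toLinearMap))
instance : Module ℂ (Image P) := inferInstanceAs (Module ℂ (LinearMap.range P.toLinearMap))

variable {P}

/-- An element of the image as an element of `Y`. -/
def val (y : Image P) : Y := y.1

/-- The element `P z` of the image. -/
def of (z : T) : Image P := ⟨P z, z, rfl⟩

theorem ext {y z : Image P} (h : y.val = z.val) : y = z := Subtype.ext h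

theorem exists_of (y : Image P) : ∃ z : T, P z = y.val := y.2

@[simp] theorem val_add (y z : Image P) : (y + z).val = y.val + z.val := rfl
@[simp] theorem val_smul (c : ℂ) (y : Image P) : (c • y).val = c • y.val := rfl
@[simp] theorem val_zero : (0 : Image P).val = 0 := rfl

/-- The inclusion of the image in `Y`. -/
def valL : Image P →ₗ[ℂ] Y where
  toFun := val
  map_add' _ _ := rfl
  map_smul' _ _ := rfl

/-- The quotient norm of `M_ι(T / ker P) = M_ι(T) / M_ι(ker P)`: the norm of a matrix `y` over the
image is the infimum of the norms of its preimages `z ∈ M_ι(T)`. -/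
def matrixNorm {ι : Type} [Fintype ι] (y : Matrix ι ι (Image P)) : ℝ :=
  sInf {r : ℝ | ∃ z : Matrix ι ι T, (∀ i j, P (z i j) = (y i j).val) ∧ r = mnorm z}

variable {ι κ : Type} [Fintype ι] [Fintype κ]

theorem bddBelow (y : Matrix ι ι (Image P)) :
    BddBelow {r : ℝ | ∃ z : Matrix ι ι T, (∀ i j, P (z i j) = (y i j).val) ∧ r = mnorm z} :=
  ⟨0, by rintro _ ⟨z, -, rfl⟩; exact mnorm_nonneg z⟩

theorem matrixNorm_le {y : Matrix ι ι (Image P)} {z : Matrix ι ι T}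
    (h : ∀ i j, P (z i j) = (y i j).val) : matrixNorm y ≤ mnorm z :=
  csInf_le (bddBelow y) ⟨z, h, rfl⟩

theorem exists_lift {y : Matrix ι ι (Image P)} {c : ℝ} (h : matrixNorm y < c) :
    ∃ z : Matrix ι ι T, (∀ i j, P (z i j) = (y i j).val) ∧ mnorm z < c := by
  obtain ⟨r, ⟨z, hz, rfl⟩, hr⟩ := exists_lt_of_csInf_lt (by
    choose z hz using fun i j => exists_of (y i j)
    exact ⟨_, Matrix.of z, hz, rfl⟩) h
  exact ⟨z, hz, hr⟩

theorem matrixNorm_nonneg (y : Matrix ι ι (Image P)) : 0 ≤ matrixNorm y :=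
  Real.sInf_nonneg (by rintro _ ⟨z, -, rfl⟩; exact mnorm_nonneg z)

theorem matrixNorm_sandwich_le [DecidableEq ι] [DecidableEq κ] (α : Matrix κ ι ℂ)
    (y : Matrix ι ι (Image P)) (β : Matrix ι κ ℂ) :
    matrixNorm (sandwich α y β) ≤ ‖α‖ * matrixNorm y * ‖β‖ := by
  have key : ∀ ε > 0, matrixNorm (sandwich α y β) ≤ ‖α‖ * (matrixNorm y + ε) * ‖β‖ :=
    fun ε hε => by
      obtain ⟨z, hz, hc⟩ := exists_lift (show matrixNorm y < matrixNorm y + ε by linarith)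
      refine (matrixNorm_le (z := sandwich α z β) fun i j => ?_).trans
        ((mnorm_sandwich_le α z β).trans (by gcongr))
      change _ = valL (sandwich α y β i j)
      simp only [sandwich, Matrix.of_apply, map_sum, map_smul, hz]
      rfl
  have ht : Filter.Tendsto (fun ε : ℝ => ‖α‖ * (matrixNorm y + ε) * ‖β‖)
      (nhdsWithin 0 (Set.Ioi 0)) (nhds (‖α‖ * matrixNorm y * ‖β‖)) := by
    have : Continuous fun ε : ℝ => ‖α‖ * (matrixNorm y + ε) * ‖β‖ := by fun_prop
    have := this.tendsto 0
    simp only [add_zero] at this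
    exact this.mono_left nhdsWithin_le_nhds
  exact ge_of_tendsto ht (Filter.eventually_of_mem self_mem_nhdsWithin fun ε hε => key ε hε)

theorem matrixNorm_submatrix_le (y : Matrix ι ι (Image P)) (f : κ → ι)
    (hf : Function.Injective f) : matrixNorm (y.submatrix f f) ≤ matrixNorm y := by
  refine le_of_forall_pos_le_add fun ε hε => ?_
  obtain ⟨z, hz, hc⟩ := exists_lift (show matrixNorm y < matrixNorm y + ε by linarith)
  exact (matrixNorm_le (z := z.submatrix f f) fun i j => hz _ _).trans
    ((mnorm_submatrix_le z f hf).trans hc.le)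

variable (P) in
/-- The quotient matrix norm on the image. -/
def matrixSeminorm : MatrixSeminorm (Image P) where
  toFun := matrixNorm
  add_le y y' := by
    refine le_of_forall_pos_le_add fun ε hε => ?_
    obtain ⟨z, hz, hc⟩ := exists_lift (show matrixNorm y < matrixNorm y + ε / 2 by linarith)
    obtain ⟨z', hz', hc'⟩ := exists_lift (show matrixNorm y' < matrixNorm y' + ε / 2 by linarith)
    refine (matrixNorm_le (z := z + z') fun i j => ?_).trans ((mnorm_add_le z z').trans
      (by linarith))
    simp [hz, hz']
  smul {ι} _ c y := by
    have key : ∀ (c : ℂ) (y : Matrix ι ι (Image P)),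
        matrixNorm (c • y) ≤ ‖c‖ * matrixNorm y := fun c y => by
      have h1 : ∀ ε > 0, matrixNorm (c • y) ≤ ‖c‖ * (matrixNorm y + ε) := fun ε hε => by
        obtain ⟨z, hz, hc⟩ := exists_lift (show matrixNorm y < matrixNorm y + ε by linarith)
        refine (matrixNorm_le (z := c • z) fun i j => ?_).trans ((mnorm_smul c z).le.trans
          (by gcongr))
        simp [hz]
      have ht : Filter.Tendsto (fun ε : ℝ => ‖c‖ * (matrixNorm y + ε))
          (nhdsWithin 0 (Set.Ioi 0)) (nhds (‖c‖ * matrixNorm y)) := by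
        have : Continuous fun ε : ℝ => ‖c‖ * (matrixNorm y + ε) := by fun_prop
        have := this.tendsto 0
        simp only [add_zero] at this
        exact this.mono_left nhdsWithin_le_nhds
      exact ge_of_tendsto ht (Filter.eventually_of_mem self_mem_nhdsWithin fun ε hε => h1 ε hε)
    refine le_antisymm (key c y) ?_
    by_cases hc : c = 0
    · subst hc
      simpa using matrixNorm_nonneg ((0 : ℂ) • y)
    · have := key c⁻¹ (c • y)
      rw [smul_smul, inv_mul_cancel₀ hc, one_smul, norm_inv] at this
      have hc' : 0 < ‖c‖ := norm_pos_iff.2 hc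
      calc _ ≤ ‖c‖ * (‖c‖⁻¹ * matrixNorm (c • y)) := by gcongr
        _ = _ := by field_simp
  M1 y y' := by
    refine le_antisymm (le_of_forall_pos_le_add fun ε hε => ?_) (max_le ?_ ?_)
    · obtain ⟨z, hz, hc⟩ := exists_lift (show matrixNorm y < matrixNorm y + ε by linarith)
      obtain ⟨z', hz', hc'⟩ := exists_lift (show matrixNorm y' < matrixNorm y' + ε by linarith)
      refine (matrixNorm_le (z := Matrix.fromBlocks z 0 0 z') fun i j => ?_).trans ?_
      · cases i <;> cases j <;> simp [hz, hz']
      · rw [mnorm_fromBlocks, ← max_add_add_right]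
        exact max_le_max hc.le hc'.le
    · exact matrixNorm_submatrix_le (Matrix.fromBlocks y 0 0 y') Sum.inl Sum.inl_injective
    · exact matrixNorm_submatrix_le (Matrix.fromBlocks y 0 0 y') Sum.inr Sum.inr_injective
  M2 α y β := matrixNorm_sandwich_le α y β

instance : NormedAddCommGroup (Image P) :=
  (matrixSeminorm P).toNormed fun y h => by
    refine ext ?_
    rw [val_zero, ← norm_le_zero_iff]
    have key : ∀ ε > 0, ‖y.val‖ ≤ ‖P‖ * ε := fun ε hε => by
      obtain ⟨z, hz, hc⟩ := exists_lift (y := unit y) (c := ε) (by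
        change matrixNorm (unit y) = 0 at h
        rw [h]; exact hε)
      have h1 := hz () ()
      change _ = y.val at h1
      rw [← h1]
      exact (P.le_opNorm _).trans (by gcongr; exact (norm_entry_le z () ()).trans hc.le)
    have ht : Filter.Tendsto (fun ε : ℝ => ‖P‖ * ε) (nhdsWithin 0 (Set.Ioi 0)) (nhds 0) := by
      have : Continuous fun ε : ℝ => ‖P‖ * ε := by fun_prop
      have := this.tendsto 0
      simp only [mul_zero] at this
      exact this.mono_left nhdsWithin_le_nhds
    exact ge_of_tendsto ht (Filter.eventually_of_mem self_mem_nhdsWithin fun ε hε => key ε hε)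

instance : NormedSpace ℂ (Image P) where
  norm_smul_le c y := ((matrixSeminorm P).smul c (unit y)).le

/-- The image carries the operator space structure of the quotient `T / ker P`. -/
instance : OperatorSpace (Image P) where
  toMatrixSeminorm := matrixSeminorm P
  norm_unit _ := rfl

end Image

end Image

section Nuclear

variable (V W X : Type*) [NormedAddCommGroup V] [NormedSpace ℂ V] [OperatorSpace V]
  [NormedAddCommGroup W] [NormedSpace ℂ W] [OperatorSpace W]
  [NormedAddCommGroup X] [NormedSpace ℂ X] [OperatorSpace X] [CompleteSpace X]

/-- The operator space `N(V × W, X)` of completely nuclear bilinear maps: the image of `Ψ` in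
`JCB(V × W, X)`, identified with `((V* ⊗^ W*) ⊗^ X) / ker Ψ`. -/
abbrev NuclearBilin : Type _ := Image (psi V W X)

/-- The operator space `L_N(V, X)` of completely nuclear linear maps: the image of the canonical
map `V* ⊗^ X → CB(V, X)`, identified with `(V* ⊗^ X) / ker`. -/
abbrev NuclearLin : Type _ := Image (linPsi V X)

end Nuclear

section CompleteIsometry

/-- A complete isometry: a linear map that preserves the norms of all matrices. -/
def IsCompleteIsometry {V W : Type*} [NormedAddCommGroup V] [NormedSpace ℂ V] [OperatorSpace V]
    [NormedAddCommGroup W] [NormedSpace ℂ W] [OperatorSpace W] (e : V →ₗ[ℂ] W) : Prop :=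
  ∀ (n : ℕ) (v : Matrix (Fin n) (Fin n) V), mnorm (v.map e) = mnorm v

end CompleteIsometry

end OpSp

end

noncomputable section

open scoped Matrix.Norms.L2Operator

namespace OpSp

/-! ### Comparison of two quotient structures through maps between their sources -/

section ImageComparison

variable {S T Y Z E : Type*} [NormedAddCommGroup S] [NormedSpace ℂ S] [OperatorSpace S]
  [NormedAddCommGroup T] [NormedSpace ℂ T] [OperatorSpace T]
  [NormedAddCommGroup Y] [NormedSpace ℂ Y] [NormedAddCommGroup Z] [NormedSpace ℂ Z]
  [AddCommGroup E] [Module ℂ E] {P : S →L[ℂ] Y} {Q : T →L[ℂ] Z}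

/-! Write `T` for the projective tensor product of `V*` and `W*`. Both spaces of nuclear maps are
images carrying a quotient structure: `Ψ` is defined on the projective tensor product of `T` with
`ℂ`, and `L_Ψ` on `T` itself. The matrix norms of such an image depend only on the matrix norms of
the source and on the fibres of the map; the norms of `JCB(V × W, ℂ)` and `CB(V, W*)` do not enter.
So both targets may be regarded as subspaces of the space of all bilinear forms on `V × W`, with no
norm there, and no isometry between them has to be known.

Tensoring with `ℂ` changes nothing: `t ⊗ c ↦ c t` and `t ↦ t ⊗ 1` pass between the two sources.
These passages turn `Ψ` and `L_Ψ` into each other, because both canonical maps send `f ⊗ g`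
(tensored with `1` in the case of `Ψ`) to the form `(v, w) ↦ f(v) g(w)`. Hence the two images
consist of the same forms, and a matrix of forms has the same quotient norm in both.

For the last conclusion the two passages need not be known to be inverse to each other. It is enough
that each is contractive on all matrix levels and intertwines the canonical maps. A lift of a matrix
of forms is then carried to a lift of the same matrix for the other map, of no larger norm, and
taking infima in both directions gives equality. This is `Image.exists_completeIsometry`.

Two kinds of facts feed it. The bounds are `mnorm_map_projLift_smulJCB_le`, where scalar
multiplication `T × ℂ → T` has jointly completely bounded norm at most `1` and so induces a complete
contraction, and `mnorm_map_tmulOne_le`, which is the inequality `‖t ⊗ 1‖ ≤ ‖t‖ ‖1‖` for matrices.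
The intertwining relations are `linPsi_projLift_smulJCB` for the first passage and `psi_tmul_apply`
with `linPsi_apply_eq` for the second; the density arguments behind them compare values at a fixed
pair `(v, w)`, which depend continuously on the tensor. -/

theorem Image.mnorm_le_of_lift {a : S → T}
    (ha : ∀ (n : ℕ) (s : Matrix (Fin n) (Fin n) S), mnorm (s.map a) ≤ mnorm s)
    {n : ℕ} {y : Matrix (Fin n) (Fin n) (Image P)} {z : Matrix (Fin n) (Fin n) (Image Q)}
    (h : ∀ i j s, P s = (y i j).val → Q (a s) = (z i j).val) : mnorm z ≤ mnorm y := by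
  -- The infimum defining the quotient norm need not be attained, so a lift of `y` is taken within
  -- `ε` of it. Its image under `a` is a lift of `z`, hence one of the competitors in the infimum
  -- for `z`. Neither linearity nor continuity of `a` plays a role.
  refine le_of_forall_pos_le_add fun ε hε => ?_
  obtain ⟨s, hs, hc⟩ := Image.exists_lift (y := y) (c := mnorm y + ε)
    (show mnorm y < mnorm y + ε by linarith)
  exact (Image.matrixNorm_le (z := s.map a) fun i j => h i j _ (hs i j)).trans
    ((ha n s).trans hc.le)

/-- The images of two maps `P : S → Y` and `Q : T → Z`, regarded inside a common space `E`, are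
completely isometric if each of `P` and `Q` factors through the other one by a map that is
contractive on all matrix levels. -/
theorem Image.exists_completeIsometry {i : Y →ₗ[ℂ] E} {k : Z →ₗ[ℂ] E}
    (hi : Function.Injective i) (hk : Function.Injective k) {a : S → T} {b : T → S}
    (ha : ∀ (n : ℕ) (s : Matrix (Fin n) (Fin n) S), mnorm (s.map a) ≤ mnorm s)
    (hb : ∀ (n : ℕ) (t : Matrix (Fin n) (Fin n) T), mnorm (t.map b) ≤ mnorm t)
    (hP : ∀ s, k (Q (a s)) = i (P s)) (hQ : ∀ t, i (P (b t)) = k (Q t)) :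
    ∃ e : Image P ≃ₗ[ℂ] Image Q, (∀ y, k (e y).val = i y.val) ∧
      IsCompleteIsometry (e : Image P →ₗ[ℂ] Image Q) := by
  -- The relation `hP` says that every value of `P`, seen in `E`, is also a value of `Q`: if `P s`
  -- represents `y`, then `Q (a s)` is the required element.
  have hf : ∀ y : Image P, ∃ z : Image Q, k z.val = i y.val := fun y => by
    obtain ⟨s, hs⟩ := y.exists_of
    exact ⟨Image.of (a s), by rw [← hs]; exact hP s⟩
  choose f hf using hf
  -- The choice in `f` is harmless: `k` is injective, so `f y` is determined by `k (f y) = i y`, and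
  -- the right-hand side is linear in `y`. Linearity of `F` comes from there and not from `a`.
  let F : Image P →ₗ[ℂ] Image Q :=
    { toFun := f
      map_add' := fun y y' => Image.ext (hk (by simp [hf]))
      map_smul' := fun c y => Image.ext (hk (by simp [hf])) }
  have hF : Function.Bijective F := by
    refine ⟨fun y y' h => Image.ext (hi ?_), fun z => ?_⟩
    · rw [← hf, ← hf]
      exact congrArg (fun z : Image Q => k z.val) h
    · obtain ⟨t, ht⟩ := z.exists_of
      -- By `hQ`, the element `P (b t)` represents the same member of `E` as `Q t`, so it is the
      -- preimage.
      refine ⟨Image.of (b t), Image.ext (hk ((hf _).trans ?_))⟩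
      rw [← ht]
      exact hQ t
  -- Transporting lifts by `a` shows that `F` is completely contractive; transporting them by `b`,
  -- with `P` and `Q` exchanged, shows the same for its inverse.
  refine ⟨LinearEquiv.ofBijective F hF, hf, fun n y => le_antisymm ?_ ?_⟩
  · refine Image.mnorm_le_of_lift ha fun r c s hs => hk ?_
    rw [hP, hs]
    exact (hf _).symm
  · refine Image.mnorm_le_of_lift hb fun r c t ht => hi ?_
    rw [hQ, ht]
    exact hf _

end ImageComparison

/-! ### The two completely contractive maps between `T` and its projective tensor product with `ℂ`
-/

section TensorScalar

variable {T V W : Type*} [NormedAddCommGroup T] [NormedSpace ℂ T] [OperatorSpace T]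
  [NormedAddCommGroup V] [NormedSpace ℂ V] [OperatorSpace V]
  [NormedAddCommGroup W] [NormedSpace ℂ W] [OperatorSpace W]

theorem sandwich_one {U ι : Type*} [AddCommGroup U] [Module ℂ U] [Fintype ι] [DecidableEq ι]
    (u : Matrix ι ι U) : sandwich 1 u 1 = u := by
  ext i j
  simp [sandwich, Matrix.one_apply]

/-- The matrix `v ⊗ w` represents itself, with identity matrices as the scalar factors `α` and `β`,
and this representation bounds the infimum. The identity has norm at most `1`, with norm `0`
possible for an empty index set. -/
theorem mnorm_matTmul_le {ι τ : Type} [Fintype ι] [Fintype τ] (v : Matrix ι ι V)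
    (w : Matrix τ τ W) : mnorm (matTmul v w) ≤ mnorm v * mnorm w := by
  classical
  have h : Rep (matTmul v w) 1 (mnorm v) (mnorm w) 1 :=
    ⟨ι, τ, inferInstance, inferInstance, inferInstance, inferInstance, 1, v, w, 1,
      (sandwich_one _).symm, l2_one_le, le_rfl, le_rfl, l2_one_le⟩
  exact h.projNorm_le.trans (by rw [one_mul, mul_one])

/-- Up to exchanging the two index factors, which preserves the norm, this is the Kronecker product
of a scalar matrix with `t`. The factor `1` is kept so that the same estimate proves both that
scalar multiplication is jointly completely bounded and that its norm is at most `1`. -/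
theorem mnorm_smul_kron_le {n : ℕ} (t : Matrix (Fin n) (Fin n) T)
    (c : Matrix (Fin n) (Fin n) ℂ) :
    mnorm (Matrix.kroneckerMap (fun t c => LinearMap.lsmul ℂ T c t) t c)
      ≤ 1 * (mnorm t * mnorm c) := by
  rw [one_mul, mul_comm, ← mnorm_submatrix_equiv _ (Equiv.prodComm (Fin n) (Fin n))]
  exact mnorm_kron_le c t

variable (T) in
/-- Scalar multiplication as a jointly completely bounded bilinear map `T × ℂ → T`. -/
def smulJCB : JCB T ℂ T := JCB.mk (LinearMap.lsmul ℂ T).flip ⟨1, fun _ => mnorm_smul_kron_le⟩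

@[simp] theorem smulJCB_apply (t : T) (c : ℂ) : smulJCB T t c = c • t := rfl

theorem norm_smulJCB_le : ‖smulJCB T‖ ≤ 1 :=
  JCB.norm_le zero_le_one fun _ => mnorm_smul_kron_le

/-- A jointly completely bounded bilinear map extends to the projective tensor product with
amplifications bounded by its norm; for scalar multiplication that norm is at most `1`. The
extension is the passage `t ⊗ c ↦ c t`. -/
theorem mnorm_map_projLift_smulJCB_le [CompleteSpace T] {κ : Type} [Fintype κ]
    (s : Matrix κ κ (ProjTensor T ℂ)) : mnorm (s.map (projLift (smulJCB T))) ≤ mnorm s :=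
  (projLift_bound _ s).trans
    ((mul_le_mul_of_nonneg_right norm_smulJCB_le (mnorm_nonneg s)).trans (one_mul _).le)

/-- The map `T → T ⊗^ ℂ`, `t ↦ t ⊗ 1`. -/
def tmulOne (t : T) : ProjTensor T ℂ := ((tmul t (1 : ℂ) : AlgTensor T ℂ) : ProjTensor T ℂ)

theorem mnorm_map_tmulOne_le {κ : Type} [Fintype κ] (t : Matrix κ κ T) :
    mnorm (t.map tmulOne) ≤ mnorm t := by
  -- With `1` viewed as a `1 × 1` matrix, the matrix of the `t i j ⊗ 1` is `t ⊗ 1`, indexed by `κ ×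
  -- Unit` and relabelled by `κ`. The bound for `v ⊗ w` then applies, and the inclusion in the
  -- completion preserves matrix norms.
  have e : t.map tmulOne = toComplMatrix ((matTmul t (unit (1 : ℂ))).submatrix
      (Equiv.prodPUnit.{0} κ).symm (Equiv.prodPUnit.{0} κ).symm) := rfl
  rw [e, mnorm_coe, mnorm_submatrix_equiv]
  refine (mnorm_matTmul_le _ _).trans ?_
  rw [mnorm_unit, norm_one, mul_one]

/-- Sums of elementary tensors exhaust the algebraic tensor product, which is dense in the completed
one. This reduces the identities between canonical maps to elementary tensors. -/
theorem ProjTensor.continuousLinearMap_ext {Y : Type*} [NormedAddCommGroup Y] [NormedSpace ℂ Y]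
    {f g : ProjTensor V W →L[ℂ] Y}
    (h : ∀ v w, f (tmul v w : AlgTensor V W) = g (tmul v w : AlgTensor V W)) : f = g := by
  refine ContinuousLinearMap.ext fun t => UniformSpace.Completion.induction_on t
    (isClosed_eq f.continuous g.continuous) fun a => ?_
  refine AlgTensor.induction (P := fun a => f (a : ProjTensor V W) = g (a : ProjTensor V W)) h
    (fun x y hx hy => ?_) a
  rw [UniformSpace.Completion.coe_add, map_add, map_add, hx, hy]

end TensorScalar

/-! ### The canonical maps as bilinear forms: intertwining relations -/

section Evaluation

variable {V W X : Type*} [NormedAddCommGroup V] [NormedSpace ℂ V] [OperatorSpace V]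
  [NormedAddCommGroup W] [NormedSpace ℂ W] [OperatorSpace W]
  [NormedAddCommGroup X] [NormedSpace ℂ X] [OperatorSpace X]

/-- Evaluation at `v` as a continuous linear map. -/
def CB.evL (v : V) : CB V X →L[ℂ] X :=
  LinearMap.mkContinuous (CB.ev v) ‖v‖ fun φ => (CB.norm_bound φ v).trans (mul_comm _ _).le

/-- Evaluation at `(v, w)` as a continuous linear map. -/
def JCB.evL (v : V) (w : W) : JCB V W X →L[ℂ] X :=
  LinearMap.mkContinuous (JCB.ev (v, w)) (‖v‖ * ‖w‖) fun φ =>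
    (JCB.norm_bound φ v w).trans (mul_comm _ _).le

/-- `CB(V, W*)` inside the bilinear forms on `V × W`. -/
def CB.toBilin : CB V (Dual W) →ₗ[ℂ] V →ₗ[ℂ] W →ₗ[ℂ] ℂ where
  toFun φ := LinearMap.mk₂ ℂ (fun v w => φ v w)
    (fun v v' w => by rw [map_add]; rfl) (fun c v w => by rw [map_smul]; rfl)
    (fun v w w' => map_add _ _ _) (fun c v w => map_smul _ _ _)
  map_add' _ _ := rfl
  map_smul' _ _ := rfl

theorem CB.toBilin_injective :
    Function.Injective (CB.toBilin : CB V (Dual W) →ₗ[ℂ] V →ₗ[ℂ] W →ₗ[ℂ] ℂ) := fun φ ψ h => by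
  ext v w
  exact LinearMap.congr_fun₂ h v w

/-- `JCB(V × W, ℂ)` inside the bilinear forms on `V × W`. -/
def JCB.toBilinₗ : JCB V W ℂ →ₗ[ℂ] V →ₗ[ℂ] W →ₗ[ℂ] ℂ := (jcbSubmodule V W ℂ).subtype

theorem JCB.toBilinₗ_injective :
    Function.Injective (JCB.toBilinₗ : JCB V W ℂ →ₗ[ℂ] V →ₗ[ℂ] W →ₗ[ℂ] ℂ) :=
  Subtype.val_injective

/-- For fixed `v` and `w` both sides are continuous and linear in `t`, and at `f ⊗ g` both equal
`f(v) g(w)`. Composing with the evaluations makes the two maps comparable, since before that they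
take values in different spaces. -/
theorem linPsi_apply_eq (t : ProjTensor (Dual V) (Dual W)) (v : V) (w : W) :
    linPsi V (Dual W) t v w = projLift (bilinFormJCB V W) t v w := by
  have h : ((CB.evL w).comp (CB.evL v)).comp (linPsi V (Dual W)) =
      (JCB.evL v w).comp (projLift (bilinFormJCB V W)) :=
    ProjTensor.continuousLinearMap_ext fun f g => by
      simp only [ContinuousLinearMap.comp_apply, linPsi, projLift_tmul]
      rfl
  exact DFunLike.congr_fun h t

/-- The bilinear map that induces `psi` is defined on the completed product of `V*` and `W*`, so the
formula holds for every `t` there and not only for elementary tensors; no density argument is needed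
in the inner factor. -/
theorem psi_tmul_apply (t : ProjTensor (Dual V) (Dual W)) (c : ℂ) (v : V) (w : W) :
    psi V W ℂ (tmul t c : AlgTensor (ProjTensor (Dual V) (Dual W)) ℂ) v w =
      projLift (bilinFormJCB V W) t v w * c := by
  rw [psi, projLift_tmul]
  rfl

/-- This is the relation `L_Ψ ∘ a = Ψ` for `a : t ⊗ c ↦ c t`, read inside the bilinear forms. By
density it suffices to take `s = t ⊗ c` with `t` arbitrary; then `c` comes out by linearity, and
what remains is `linPsi_apply_eq`. -/
theorem linPsi_projLift_smulJCB (s : ProjTensor (ProjTensor (Dual V) (Dual W)) ℂ) (v : V)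
    (w : W) : linPsi V (Dual W) (projLift (smulJCB _) s) v w = psi V W ℂ s v w := by
  have h : (((CB.evL w).comp (CB.evL v)).comp (linPsi V (Dual W))).comp (projLift (smulJCB _)) =
      (JCB.evL v w).comp (psi V W ℂ) :=
    ProjTensor.continuousLinearMap_ext fun t c => by
      rw [ContinuousLinearMap.comp_apply, projLift_tmul, smulJCB_apply, map_smul]
      refine (congrArg (c • ·) (linPsi_apply_eq t v w)).trans ?_
      exact (mul_comm _ _).trans (psi_tmul_apply t c v w).symm
  exact DFunLike.congr_fun h s

end Evaluation

end OpSp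

end

/-- The completely nuclear bilinear forms on `V × W` are completely isometric to the completely
nuclear linear maps from `V` to `W*`, through `φ ↦ L_φ`, `L_φ(v)(w) = φ(v, w)`. -/
theorem mainTheorem9 {V W : Type*}
    [NormedAddCommGroup V] [NormedSpace ℂ V] [OpSp.OperatorSpace V] [CompleteSpace V]
    [NormedAddCommGroup W] [NormedSpace ℂ W] [OpSp.OperatorSpace W] [CompleteSpace W] :
    ∃ e : OpSp.NuclearBilin V W ℂ ≃ₗ[ℂ] OpSp.NuclearLin V (OpSp.Dual W),
      (∀ (φ : OpSp.NuclearBilin V W ℂ) (v : V) (w : W), (e φ).val v w = φ.val v w) ∧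
      OpSp.IsCompleteIsometry (e : OpSp.NuclearBilin V W ℂ →ₗ[ℂ] OpSp.NuclearLin V (OpSp.Dual W)) := by
  obtain ⟨e, he, hi⟩ := OpSp.Image.exists_completeIsometry
    (P := OpSp.psi V W ℂ) (Q := OpSp.linPsi V (OpSp.Dual W))
    -- The common space `E` is the space of all bilinear forms on `V × W`. Agreement of `e φ` and
    -- `φ` in it is exactly the formula `L_φ(v)(w) = φ(v, w)`.
    OpSp.JCB.toBilinₗ_injective OpSp.CB.toBilin_injective
    (fun _ => OpSp.mnorm_map_projLift_smulJCB_le) (fun _ => OpSp.mnorm_map_tmulOne_le)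
    (fun s => LinearMap.ext₂ (OpSp.linPsi_projLift_smulJCB s))
    -- The relation `Ψ (t ⊗ 1) = L_Ψ t`: the scalar factor in the value of `Ψ (t ⊗ c)` is `c = 1`
    -- and disappears.
    (fun t => LinearMap.ext₂ fun v w => by
      refine (OpSp.psi_tmul_apply t 1 v w).trans ?_
      rw [mul_one]
      exact (OpSp.linPsi_apply_eq t v w).symm)
  exact ⟨e, fun φ => LinearMap.congr_fun₂ (he φ), hi⟩
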